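/- **Definitions.** A *weakly ordered set* $(P,\le)$ is a set with a reflexive and antisymmetric relation $\le$ such that for all $a\le b$, $b\le c$, $c\le d$ in $P$: $(b,c,d)$ and $(a,b,d)$ are transitive triples if and only if $(a,b,c)$ and $(a,c,d)$ are, where $(a,b,c)$ is a *transitive triple* if $a\le b$, $b\le c$ and $a\le c$. It is *homogeneous* if there is a function $\ell$ from the set of comparable pairs $a\le b$ to $\mathbb Z_{\ge 0}$ with $\ell(a\le c)=\ell(a\le b)+\ell(b\le c)$ for every transitive triple $(a,b,c)$, and $\ell(a\le b)=0$ if and only if $a=b$; for a poset this is the usual notion of a homogeneous poset. Write $a<b$ if $a\le b$ and $a\ne b$, and $[a,b]=\{x : a\le x,\ x\le b\}$. A *weak chain* from $a$ to $b$ (for $\le$) is a sequence $a=c_1<c_2<\dots<c_n=b$ with $n\ge 1$, in which only consecutive members are required to be comparable; write $a\le_t b$ if there is a weak chain from $a$ to $b$. A *lattice* is a poset in which any two elements have a join and a meet. An *automorphism* of $(P,\le)$ is a bijection $\varphi:P\to P$ with $a\le b\iff\varphi(a)\le\varphi(b)$. If $\varphi(x)>x$ for all $x$, let $a\le_\varphi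 b$ mean that $a\le b$ and $a,b\in[x,\varphi(x)]$ for some $x\in P$; we say that $\varphi$ *generates* $\le$ if, whenever $a\le b$, there is a weak chain for $\le_\varphi$ from $a$ to $b$. Let $X_\varphi$ be (the geometric realization of) the simplicial complex with vertex set $P$ whose simplices are the nonempty finite sets of pairwise comparable elements contained in $[x,\varphi(x)]$ for some $x\in P$. **Theorem.** Let $(P,\le)$ be a homogeneous weakly ordered set with an automorphism $\varphi$ that generates $\le$, such that 1. $\varphi(x)>x$ for all $x\in P$; 2. $X_\varphi$ is simply connected (in particular nonempty and connected); 3. for every $x\in P$, the interval $[x,\varphi(x)]$, with the restriction of $\le$, is a lattice. Then $\le_t$ is a partial order on $P$; for every $x\in P$, the sets $\{y\in P : x\le_t y\}$ and $\{y\in P : y\le_t x\}$, ordered by $\le_t$, are homogeneous lattices; and $X_\varphi$ is contractible. -/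

import Mathlib

namespace WeakOrd

/-! ### Weakly ordered sets

A relation `r : P → P → Prop` is read as `a ≤ b`. -/

/-- `(a, b, c)` is a transitive triple: `a ≤ b`, `b ≤ c` and `a ≤ c`. -/
def TransTriple {P : Type*} (r : P → P → Prop) (a b c : P) : Prop :=
  r a b ∧ r b c ∧ r a c

/-- `r` makes `P` a weakly ordered set: it is reflexive and antisymmetric, and satisfies the
associativity law for transitivity. -/
structure IsWeakOrder {P : Type*} (r : P → P → Prop) : Prop where
  refl : ∀ a, r a a
  antisymm : ∀ a b, r a b → r b a → a = b
  assoc : ∀ a b c d, r a b → r b c → r c d →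
    ((TransTriple r b c d ∧ TransTriple r a b d) ↔ (TransTriple r a b c ∧ TransTriple r a c d))

/-- The strict relation `a < b`. -/
def Strict {P : Type*} (r : P → P → Prop) (a b : P) : Prop :=
  r a b ∧ a ≠ b

/-- There is a weak chain `a = c₁ < c₂ < ⋯ < cₙ = b` (`n ≥ 1`) with first member `a` and last
member `b`; only consecutive members have to be comparable.
This is the relation `≤_t` generated by `r`. -/
def WeakChainRel {P : Type*} (r : P → P → Prop) : P → P → Prop :=
  Relation.ReflTransGen (Strict r)

/-- The interval `[a, b]`. -/
def interval {P : Type*} (r : P → P → Prop) (a b : P) : Set P :=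
  {x | r a x ∧ r x b}

/-- `x` is the join of the set `S`. -/
def IsJoin {P : Type*} (r : P → P → Prop) (S : Set P) (x : P) : Prop :=
  (∀ s ∈ S, r s x) ∧ ∀ y, (∀ s ∈ S, r s y) → r x y

/-- `x` is the meet of the set `S`. -/
def IsMeet {P : Type*} (r : P → P → Prop) (S : Set P) (x : P) : Prop :=
  (∀ s ∈ S, r x s) ∧ ∀ y, (∀ s ∈ S, r y s) → r y x

/-- `(P, r)` is a lattice: a poset in which any two elements have a join and a meet. -/
structure IsLatticeRel {P : Type*} (r : P → P → Prop) : Prop where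
  isPartialOrder : IsPartialOrder P r
  exists_join : ∀ a b : P, ∃ x, IsJoin r {a, b} x
  exists_meet : ∀ a b : P, ∃ x, IsMeet r {a, b} x

/-- `(P, r)` is homogeneous: there is a length function on comparable pairs with values in the
non-negative integers, additive along transitive triples, and vanishing exactly on the pairs
`a ≤ a`. The values of `ℓ` on non-comparable pairs are never used. -/
def IsHomogeneous {P : Type*} (r : P → P → Prop) : Prop :=
  ∃ ℓ : P → P → ℕ,
    (∀ a b c, TransTriple r a b c → ℓ a c = ℓ a b + ℓ b c) ∧
    (∀ a b, r a b → (ℓ a b = 0 ↔ a = b))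

/-- The subrelation `≤_φ` of `≤`: `a ≤ b` and both lie in `[x, φ x]` for some `x`. -/
def phiRel {P : Type*} (r : P → P → Prop) (φ : P → P) (a b : P) : Prop :=
  r a b ∧ ∃ x, a ∈ interval r x (φ x) ∧ b ∈ interval r x (φ x)

/-- `φ` generates `≤`: whenever `a ≤ b`, there is a weak chain for `≤_φ` from `a` to `b`. -/
def Generates {P : Type*} (r : P → P → Prop) (φ : P → P) : Prop :=
  ∀ a b, r a b → WeakChainRel (phiRel r φ) a b

/-- The simplicial complex `X_φ`: its simplices are the nonempty finite sets of pairwise comparable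
elements contained in some `[x, φ x]`. For a weak order, these are the underlying sets of weak
chains contained in some `[x, φ x]` (such a weak chain is a chain). If `x ≤ φ x` for all `x`, then
the vertex set is all of `P`. -/
def phiComplex {P : Type*} (r : P → P → Prop) (φ : P → P) : PreAbstractSimplicialComplex P where
  faces := {s | s.Nonempty ∧ IsChain r (s : Set P) ∧ ∃ x, (s : Set P) ⊆ interval r x (φ x)}
  isRelLowerSet_faces := by
    rintro s ⟨hs, hc, x, hx⟩
    refine ⟨hs, fun t hts ht => ⟨ht, hc.mono ?_, x, subset_trans ?_ hx⟩⟩ <;>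
      exact_mod_cast hts

/-! ### Geometric realization of a simplicial complex, with the weak (CW) topology -/

/-- The closed simplex spanned by `s`, as barycentric coordinates on the vertex set `V`. -/
def closedSimplex {V : Type*} (s : Finset V) : Set (V → ℝ) :=
  {f | (∀ v, 0 ≤ f v) ∧ (∀ v, v ∉ s → f v = 0) ∧ ∑ v ∈ s, f v = 1}

/-- The underlying set of the geometric realization: the union of all closed simplices. -/
def Realization {V : Type*} (K : PreAbstractSimplicialComplex V) : Type _ :=
  {f : V → ℝ // ∃ s ∈ K.faces, f ∈ closedSimplex s}

/-- The inclusion of a closed simplex in the geometric realization. -/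
def simplexInclusion {V : Type*} (K : PreAbstractSimplicialComplex V) (s : K.faces) :
    closedSimplex (s : Finset V) → Realization K :=
  fun f => ⟨f.1, s.1, s.2, f.2⟩

/-- The weak topology: a set is open iff its intersection with every closed simplex is open in that
simplex, which carries its Euclidean topology. -/
instance instTopologicalSpaceRealization {V : Type*} (K : PreAbstractSimplicialComplex V) : TopologicalSpace (Realization K) :=
  ⨆ s : K.faces, TopologicalSpace.coinduced (simplexInclusion K s) inferInstance

end WeakOrd

open WeakOrd

/-!
# Weakly ordered sets with a generating automorphism and simply connected `X_φ`

The relation `S a b := b ∈ [a, φ a]` is the relation `≤_φ` (`phiRel_iff`). It is again weakly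
ordered, and each `{a | S x a} = [x, φ x]` is a lattice, so `S` is the set of simple morphisms of a
Garside category with object set `P`, whose Garside morphisms are the pairs `x < φ x`
(`IsGarsideRel`, `isGarsideRel_phiRel`). The point of the proof is that this category is a poset, and
this is where simple connectedness enters, twice, through one statement: a group-valued cocycle on
the edges of a complex with simply connected realization is a coboundary (`exists_coboundary`).

* For the integer cocycle given by the length function, this yields a height function on `P`, strictly
  increasing along `S`. Hence `≤_t`, the relation generated by `S`, is a homogeneous partial order.
* Morphisms are weak chains ("words") modulo contraction of transitive triples. By induction on the
  height, two words that start with `a` and `b` in `[x, φ x]` and are equivalent can both be rewritten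
  so as to pass through `a ∨ b` (Garside's lemma, `garsideProperty`). So the category is left
  cancellative, the simple morphisms act on the set of morphisms with a given target by injections,
  and after inverting the Garside morphisms (`CancelAction.Loc`) by bijections. This gives a cocycle
  with values in a group of permutations. As it is a coboundary, there is a global section, and
  comparing it with two words from `x` to `z` shows that these are equivalent (`wordEqv_of_isWord`).

Therefore a join in `[x, φ x]` is a join for `≤_t`. Filling in a grid of such joins produces joins of
any two elements with a common lower bound. By connectedness the powers of `φ` move every element
above every other one, so such a bound always exists and `P` is a lattice; meets are common lower
bounds of maximal height.

For contractibility, a point of `X_φ` is read as a step function `γ : ℝ → P` that is monotone and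
satisfies `γ (u + 1) = φ (γ u)`: on `[0, 1)` it runs through the vertices in increasing order, with
the barycentric coordinates as lengths of the steps. Joining `γ` with the translates of the step
function `u ↦ φ ^ ⌊u⌋ x` deforms the identity of `X_φ` into the simplicial map `c ↦ c ⊔ x`, and
taking meets deforms it into `c ↦ c ⊓ x`; by absorption the composite of these maps is constant
(`contractibleSpace_realization`).
-/

open WeakOrd

/-! ### The geometric realization of a simplicial complex -/

section Realization

variable {V : Type*} {K : PreAbstractSimplicialComplex V}

theorem continuous_simplexInclusion (s : K.faces) : Continuous (simplexInclusion K s) :=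
  continuous_iff_coinduced_le.mpr
    (le_iSup (fun s : K.faces => TopologicalSpace.coinduced (simplexInclusion K s) inferInstance) s)

theorem continuous_realization_iff {Y : Type*} [TopologicalSpace Y] {f : Realization K → Y} :
    Continuous f ↔ ∀ s : K.faces, Continuous (f ∘ simplexInclusion K s) := by
  refine ⟨fun h s => h.comp (continuous_simplexInclusion s), fun h => ?_⟩
  exact continuous_iSup_dom.mpr fun s => continuous_coinduced_dom.mpr (h s)

theorem continuous_barycentric (v : V) : Continuous fun p : Realization K => p.1 v :=
  continuous_realization_iff.mpr fun _ => (continuous_apply v).comp continuous_subtype_val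

theorem face_nonempty {s : Finset V} (hs : s ∈ K.faces) : s.Nonempty :=
  (K.isRelLowerSet_faces hs).1

theorem face_of_subset {s t : Finset V} (hs : s ∈ K.faces) (hts : t ⊆ s) (ht : t.Nonempty) :
    t ∈ K.faces :=
  (K.isRelLowerSet_faces hs).2 hts ht

/-- Every point lies in the relative interior of a face, its carrier. -/
theorem exists_carrier (p : Realization K) :
    ∃ s ∈ K.faces, p.1 ∈ closedSimplex s ∧ ∀ v, v ∈ s ↔ 0 < p.1 v := by
  classical
  obtain ⟨f, s, hs, h0, hout, hsum⟩ := p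
  have hmem : ∀ v, v ∈ s.filter (fun v => 0 < f v) ↔ 0 < f v := fun v => by
    simp only [Finset.mem_filter, and_iff_right_iff_imp]
    intro h
    by_contra hv
    exact h.ne' (hout v hv)
  have hsum' : ∑ v ∈ s.filter (fun v => 0 < f v), f v = 1 := by
    rw [← hsum]
    refine Finset.sum_subset (Finset.filter_subset _ _) fun v _ hv => ?_
    rw [hmem] at hv
    exact le_antisymm (not_lt.mp hv) (h0 v)
  refine ⟨s.filter (fun v => 0 < f v), face_of_subset hs (Finset.filter_subset _ _) ?_,
    ⟨h0, fun v hv => ?_, hsum'⟩, hmem⟩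
  · by_contra hne
    rw [Finset.not_nonempty_iff_eq_empty] at hne
    simp [hne] at hsum'
  · rw [hmem] at hv
    exact le_antisymm (not_lt.mp hv) (h0 v)

theorem barycentric_nonneg (p : Realization K) (v : V) : 0 ≤ p.1 v := by
  obtain ⟨s, -, h, -⟩ := p.2
  exact h v

theorem exists_barycentric_pos (p : Realization K) : ∃ v, 0 < p.1 v := by
  obtain ⟨s, hs, -, h⟩ := exists_carrier p
  obtain ⟨v, hv⟩ := face_nonempty hs
  exact ⟨v, (h v).mp hv⟩

/-- A map into a realization is continuous as soon as its barycentric coordinates are and only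
finitely many vertices are involved: it then takes values in a finite subcomplex, which is a finite
union of closed simplices. -/
theorem continuous_of_finite_support {Z : Type*} [TopologicalSpace Z] {f : Z → Realization K}
    (W : Finset V) (hW : ∀ z v, v ∉ W → (f z).1 v = 0)
    (hf : ∀ v, Continuous fun z => (f z).1 v) : Continuous f := by
  classical
  let ι := {s : K.faces // (s : Finset V) ⊆ W}
  have : Finite ι := by
    refine Finite.of_injective (β := W.powerset) (fun s => ⟨s.1.1, Finset.mem_powerset.mpr s.2⟩) ?_
    intro s t h
    exact Subtype.ext (Subtype.ext (Subtype.mk.inj h))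
  let C : ι → Set Z := fun s => {z | ∀ v, v ∉ (s.1 : Finset V) → (f z).1 v = 0}
  have hmem : ∀ (s : ι) z, z ∈ C s → (f z).1 ∈ closedSimplex (s.1 : Finset V) := by
    intro s z hz
    refine ⟨barycentric_nonneg _, hz, ?_⟩
    obtain ⟨t, ht, ⟨-, hout, hsum⟩, hpos⟩ := exists_carrier (f z)
    rw [← hsum]
    symm
    refine Finset.sum_subset (fun v hv => ?_) fun v _ hv => hout v hv
    by_contra hvs
    exact ((hpos v).mp hv).ne' (hz v hvs)
  refine (locallyFinite_of_finite C).continuous ?_ (fun s => ?_) (fun s => ?_)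
  · refine Set.eq_univ_of_forall fun z => Set.mem_iUnion.mpr ?_
    obtain ⟨t, ht, ⟨-, hout, -⟩, hpos⟩ := exists_carrier (f z)
    refine ⟨⟨⟨t, ht⟩, fun v hv => ?_⟩, hout⟩
    by_contra hvW
    exact ((hpos v).mp hv).ne' (hW z v hvW)
  · have : C s = ⋂ v, ⋂ (_ : v ∉ (s.1 : Finset V)), {z | (f z).1 v = 0} := by
      ext z; simp [C]
    rw [this]
    exact isClosed_iInter fun v => isClosed_iInter fun _ => isClosed_eq (hf v) continuous_const
  · rw [continuousOn_iff_continuous_domRestrict]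
    have : (C s).domRestrict f =
        simplexInclusion K s.1 ∘ fun z : C s => ⟨(f z).1, hmem s z z.2⟩ := rfl
    rw [this]
    refine (continuous_simplexInclusion s.1).comp (Continuous.subtype_mk ?_ _)
    exact continuous_pi fun v => (hf v).comp continuous_subtype_val

theorem convex_closedSimplex (s : Finset V) : Convex ℝ (closedSimplex s) := by
  rintro f ⟨hf, hf', hf''⟩ g ⟨hg, hg', hg''⟩ a b ha hb hab
  refine ⟨fun v => ?_, fun v hv => ?_, ?_⟩
  · exact add_nonneg (mul_nonneg ha (hf v)) (mul_nonneg hb (hg v))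
  · simp [hf' v hv, hg' v hv]
  · simp only [Pi.add_apply, Pi.smul_apply, smul_eq_mul, Finset.sum_add_distrib, ← Finset.mul_sum,
      hf'', hg'', mul_one, hab]

instance : LocallyPathConnectedSpace (Realization K) := by
  have : ∀ s : K.faces, LocallyPathConnectedSpace (closedSimplex (s : Finset V)) := fun s =>
    (convex_closedSimplex (s : Finset V)).locallyPathConnectedSpace
  have h := LocallyPathConnectedSpace.coinduced
    (fun q : Σ s : K.faces, closedSimplex (s : Finset V) => simplexInclusion K q.1 q.2)
  convert h using 1
  simp only [instTopologicalSpaceRealization, instTopologicalSpaceSigma, coinduced_iSup,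
    coinduced_compose]
  rfl

open Classical in
/-- The point `(1 - t) u + t w` of the edge joining two vertices `u`, `w` of a face. -/
noncomputable def edgePoint {s : Finset V} (hs : s ∈ K.faces) {u w : V} (hu : u ∈ s) (hw : w ∈ s)
    (t : unitInterval) : Realization K :=
  ⟨Pi.single u (1 - (t : ℝ)) + Pi.single w (t : ℝ), s, hs, by
    have h1 : (0 : ℝ) ≤ 1 - t := by linarith [t.2.2]
    refine ⟨fun v => ?_, fun v hv => ?_, ?_⟩
    · have h2 : (0 : V → ℝ) ≤ Pi.single u (1 - (t : ℝ)) := Pi.single_nonneg.mpr h1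
      have h3 : (0 : V → ℝ) ≤ Pi.single w (t : ℝ) := Pi.single_nonneg.mpr t.2.1
      exact add_nonneg (h2 v) (h3 v)
    · have hvu : v ≠ u := fun h => hv (h ▸ hu)
      have hvw : v ≠ w := fun h => hv (h ▸ hw)
      simp [hvu, hvw]
    · simp [Finset.sum_add_distrib, hu, hw]⟩

open Classical in
theorem edgePoint_apply {s : Finset V} (hs : s ∈ K.faces) {u w : V} (hu : u ∈ s) (hw : w ∈ s)
    (t : unitInterval) (v : V) : (edgePoint hs hu hw t).1 v =
      (Pi.single u (1 - (t : ℝ)) : V → ℝ) v + (Pi.single w (t : ℝ) : V → ℝ) v := rfl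

theorem edgePoint_pos_left {s : Finset V} (hs : s ∈ K.faces) {u w : V} (hu : u ∈ s) (hw : w ∈ s)
    {t : unitInterval} (ht : t < 1) : 0 < (edgePoint hs hu hw t).1 u := by
  classical
  have h1 : (t : ℝ) < 1 := ht
  rw [edgePoint_apply]
  have h2 : (0 : V → ℝ) ≤ Pi.single w (t : ℝ) := Pi.single_nonneg.mpr t.2.1
  exact add_pos_of_pos_of_nonneg (by simpa using h1) (h2 u)

theorem edgePoint_pos_right {s : Finset V} (hs : s ∈ K.faces) {u w : V} (hu : u ∈ s) (hw : w ∈ s)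
    {t : unitInterval} (ht : 0 < t) : 0 < (edgePoint hs hu hw t).1 w := by
  classical
  have h1 : (0 : ℝ) < t := ht
  rw [edgePoint_apply]
  have h2 : (0 : V → ℝ) ≤ Pi.single u (1 - (t : ℝ)) :=
    Pi.single_nonneg.mpr (by linarith [t.2.2])
  exact add_pos_of_nonneg_of_pos (h2 w) (by simpa using h1)

theorem continuous_edgePoint {s : Finset V} (hs : s ∈ K.faces) {u w : V} (hu : u ∈ s)
    (hw : w ∈ s) : Continuous (edgePoint hs hu hw) := by
  classical
  refine continuous_of_finite_support s (fun t v hv => ?_) fun v => ?_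
  · have hvu : v ≠ u := fun h => hv (h ▸ hu)
    have hvw : v ≠ w := fun h => hv (h ▸ hw)
    simp [edgePoint_apply, hvu, hvw]
  · simp only [edgePoint_apply, Pi.single_apply]
    split_ifs <;> fun_prop

/-- The open star of a vertex. -/
def openStar (K : PreAbstractSimplicialComplex V) (v : V) : Set (Realization K) :=
  {p | 0 < p.1 v}

theorem isOpen_openStar (v : V) : IsOpen (openStar K v) :=
  isOpen_lt continuous_const (continuous_barycentric v)

/-- The vertices of a complex with connected realization are connected through its edges. -/
theorem eqvGen_of_connected [PreconnectedSpace (Realization K)] (hK : ∀ v, {v} ∈ K.faces)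
    {R : V → V → Prop} (hR : ∀ s ∈ K.faces, ∀ u ∈ s, ∀ v ∈ s, R u v) (u v : V) :
    Relation.EqvGen R u v := by
  let A : Set (Realization K) := {p | ∃ w, 0 < p.1 w ∧ Relation.EqvGen R u w}
  have hA : ∀ p : Realization K, ∀ w, 0 < p.1 w → (p ∈ A ↔ Relation.EqvGen R u w) := by
    intro p w hw
    refine ⟨fun ⟨w', hw', h⟩ => ?_, fun h => ⟨w, hw, h⟩⟩
    obtain ⟨s, hs, -, hpos⟩ := exists_carrier p
    exact h.trans _ _ _ (.rel _ _ (hR s hs w' ((hpos w').mpr hw') w ((hpos w).mpr hw)))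
  have hopen : IsOpen A := by
    have : A = ⋃ w, ⋃ (_ : Relation.EqvGen R u w), openStar K w := by
      ext p; simp [A, openStar, and_comm]
    rw [this]
    exact isOpen_iUnion fun w => isOpen_iUnion fun _ => isOpen_openStar w
  have hopen' : IsOpen Aᶜ := by
    have : Aᶜ = ⋃ w, ⋃ (_ : ¬ Relation.EqvGen R u w), openStar K w := by
      ext p
      simp only [Set.mem_compl_iff, Set.mem_iUnion, openStar, Set.mem_ofPred_eq, exists_prop]
      obtain ⟨w, hw⟩ := exists_barycentric_pos p
      exact ⟨fun h => ⟨w, fun h' => h ((hA p w hw).mpr h'), hw⟩,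
        fun ⟨w', h', hw'⟩ h => h' ((hA p w' hw').mp h)⟩
    rw [this]
    exact isOpen_iUnion fun w => isOpen_iUnion fun _ => isOpen_openStar w
  have hclopen : IsClopen A := ⟨isOpen_compl_iff.mp hopen', hopen⟩
  have hv : ∀ v : V, 0 < (edgePoint (hK v) (Finset.mem_singleton_self v)
      (Finset.mem_singleton_self v) 0).1 v := fun v => edgePoint_pos_left _ _ _ zero_lt_one
  have huniv : A = Set.univ := hclopen.eq_univ ⟨_, u, hv u, .refl u⟩
  exact (hA _ v (hv v)).mp (huniv ▸ Set.mem_univ _)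

/-- The principal bundle over the realization of `K` glued from the open stars of the vertices by
a cocycle `c` with values in a discrete group; transition functions are constant. -/
noncomputable def cocycleBundle (K : PreAbstractSimplicialComplex V) {G : Type*} [Group G]
    [TopologicalSpace G] [DiscreteTopology G] (c : V → V → G)
    (hc : ∀ s ∈ K.faces, ∀ u ∈ s, ∀ v ∈ s, ∀ w ∈ s, c u v * c v w = c u w) :
    FiberBundleCore V (Realization K) G where
  baseSet := openStar K
  isOpen_baseSet := isOpen_openStar
  indexAt p := (exists_barycentric_pos p).choose
  mem_baseSet_at p := (exists_barycentric_pos p).choose_spec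
  coordChange u v _ g := c v u * g
  coordChange_self u p hp g := by
    obtain ⟨s, hs, -, hpos⟩ := exists_carrier p
    have hu := (hpos u).mpr hp
    have := hc s hs u hu u hu u hu
    rw [mul_eq_left] at this
    rw [this, one_mul]
  continuousOn_coordChange u v :=
    ((continuous_of_discreteTopology (f := fun g : G => c v u * g)).comp
      continuous_snd).continuousOn
  coordChange_comp u v w p hp g := by
    obtain ⟨s, hs, -, hpos⟩ := exists_carrier p
    rw [← mul_assoc, hc s hs w ((hpos w).mpr hp.2) v ((hpos v).mpr hp.1.2) u ((hpos u).mpr hp.1.1)]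

/-- Cocycles on the edges of a complex with simply connected realization are coboundaries. The
covering space glued from the cocycle has a global section, whose coordinate in the chart of a
vertex `v` is constant along edges starting at `v`. -/
theorem exists_coboundary [SimplyConnectedSpace (Realization K)] (hK : ∀ v, {v} ∈ K.faces)
    {G : Type*} [Group G] (c : V → V → G)
    (hc : ∀ s ∈ K.faces, ∀ u ∈ s, ∀ v ∈ s, ∀ w ∈ s, c u v * c v w = c u w) :
    ∃ h : V → G, ∀ s ∈ K.faces, ∀ u ∈ s, ∀ v ∈ s, c u v = (h u)⁻¹ * h v := by
  let _ : TopologicalSpace G := ⊥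
  have : DiscreteTopology G := ⟨rfl⟩
  let Z := cocycleBundle K c hc
  have hcov : IsCoveringMap Z.proj := IsFiberBundle.isCoveringMap fun p =>
    ⟨Z.localTriv (Z.indexAt p), Z.mem_baseSet_at p⟩
  obtain ⟨p₀⟩ : Nonempty (Realization K) := inferInstance
  obtain ⟨σ, ⟨-, hσ⟩, -⟩ := hcov.existsUnique_continuousMap_lifts (ContinuousMap.id _) p₀
    (⟨p₀, (1 : G)⟩ : Z.TotalSpace) rfl
  have hproj : ∀ p, (σ p).proj = p := fun p => congrFun hσ p
  let F : V → Realization K → G := fun v p => (Z.localTriv v (σ p)).2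
  have hF : ∀ u v p, 0 < p.1 u → 0 < p.1 v → F v p = c v u * F u p := by
    intro u v p hu hv
    have hi : p ∈ openStar K (Z.indexAt (σ p).proj) := by
      rw [hproj]; exact Z.mem_baseSet_at p
    exact (Z.coordChange_comp (Z.indexAt (σ p).proj) u v p ⟨⟨hi, hu⟩, hv⟩ _).symm
  have hcont : ∀ v, ContinuousOn (F v) (openStar K v) := by
    intro v
    have h1 : ContinuousOn (Z.localTriv v) (Z.localTriv v).source :=
      (Z.localTriv v).continuousOn_toFun
    refine continuous_snd.comp_continuousOn (h1.comp σ.continuous.continuousOn ?_)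
    intro p hp
    rw [(Z.localTriv v).mem_source]
    change (σ p).proj ∈ openStar K v
    rwa [hproj]
  let vert : V → Realization K := fun v =>
    edgePoint (hK v) (Finset.mem_singleton_self v) (Finset.mem_singleton_self v) 0
  have hvert0 : ∀ s (hs : s ∈ K.faces) u (hu : u ∈ s) w (hw : w ∈ s),
      edgePoint hs hu hw 0 = vert u := by
    intro s hs u hu w hw
    refine Subtype.ext (funext fun v => ?_)
    classical
    simp [vert, edgePoint_apply]
  have hsymm : ∀ s (hs : s ∈ K.faces) u (hu : u ∈ s) w (hw : w ∈ s) t,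
      edgePoint hs hu hw t = edgePoint hs hw hu (unitInterval.symm t) := by
    intro s hs u hu w hw t
    refine Subtype.ext (funext fun v => ?_)
    classical
    rw [edgePoint_apply, edgePoint_apply]
    simp [add_comm]
  -- Two charts are compared at the midpoint of the edge, which lies in both open stars.
  let half : unitInterval := ⟨1 / 2, by norm_num, by norm_num⟩
  have hhalf : half < 1 := by
    change (1 / 2 : ℝ) < 1; norm_num
  have hhalf0 : 0 < half := by
    change (0 : ℝ) < 1 / 2; norm_num
  have hhalfs : unitInterval.symm half = half := by
    refine Subtype.ext ?_
    change (1 : ℝ) - 1 / 2 = 1 / 2; norm_num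
  have hconst : ∀ s (hs : s ∈ K.faces) u (hu : u ∈ s) w (hw : w ∈ s),
      F u (vert u) = F u (edgePoint hs hu hw half) := by
    intro s hs u hu w hw
    have h1 : ContinuousOn (fun t => F u (edgePoint hs hu hw t)) (Set.Iio 1) :=
      (hcont u).comp (continuous_edgePoint hs hu hw).continuousOn
        fun t ht => edgePoint_pos_left hs hu hw ht
    have h0 : (0 : unitInterval) ∈ Set.Iio 1 := Set.mem_Iio.mpr zero_lt_one
    have h2 := isPreconnected_Iio.constant h1 h0 (Set.mem_Iio.mpr hhalf)
    simpa only [hvert0] using h2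
  refine ⟨fun v => (F v (vert v))⁻¹, fun s hs u hu v hv => ?_⟩
  have e : edgePoint hs hu hv half = edgePoint hs hv hu half := by
    rw [hsymm, hhalfs]
  change c u v = ((F u (vert u))⁻¹)⁻¹ * (F v (vert v))⁻¹
  rw [inv_inv, hconst s hs u hu v hv, hconst s hs v hv u hu, e,
    hF v u _ (edgePoint_pos_left hs hv hu hhalf) (edgePoint_pos_right hs hv hu hhalf0),
    mul_inv_cancel_right]

end Realization

/-! ### Words in a locally Garside relation -/

/-- `j` is the join of `a` and `b` in the interval of all `k` with `S x k`. -/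
structure IsLocalJoin {P : Type*} (S : P → P → Prop) (x a b j : P) : Prop where
  base : S x j
  left : S a j
  right : S b j
  least : ∀ k, S x k → S a k → S b k → S j k

/-- The properties of the relation `b ∈ [a, φ a]` on which the Garside theory rests. For fixed `x`,
the set `{a | S x a}` plays the role of the simple morphisms with source `x`, the element `φ x`
that of the Garside morphism. -/
structure IsGarsideRel {P : Type*} (S : P → P → Prop) (φ : Equiv.Perm P) : Prop where
  weakOrder : IsWeakOrder S
  map_iff : ∀ a b, S (φ a) (φ b) ↔ S a b
  right_apply : ∀ a b, S a b → S b (φ a)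
  exists_join : ∀ x a b, S x a → S x b → ∃ j, IsLocalJoin S x a b j

section Words

variable {P : Type*} {S : P → P → Prop} {φ : Equiv.Perm P} {z : P}

namespace IsGarsideRel

variable (G : IsGarsideRel S φ)
include G

theorem refl (a : P) : S a a := G.weakOrder.refl a

theorem antisymm {a b : P} (h : S a b) (h' : S b a) : a = b := G.weakOrder.antisymm a b h h'

theorem apply_right (x : P) : S x (φ x) := G.right_apply x x (G.refl x)

/-- Transitivity among elements with a common lower bound. -/
theorem trans_of_base {x a b c : P} (hxa : S x a) (hxb : S x b) (hxc : S x c) (hab : S a b)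
    (hbc : S b c) : S a c :=
  (((G.weakOrder.assoc x a b c hxa hab hbc).mpr ⟨⟨hxa, hab, hxb⟩, hxb, hbc, hxc⟩).1).2.2

/-- Transitivity among elements with a common upper bound. -/
theorem trans_of_top {x b e d : P} (hxb : S x b) (hbe : S b e) (hed : S e d) (hbd : S b d)
    (hxd : S x d) : S x e :=
  (((G.weakOrder.assoc x b e d hxb hbe hed).mp ⟨⟨hbe, hed, hbd⟩, hxb, hbd, hxd⟩).1).2.2

end IsGarsideRel

variable (S z) in
/-- `w = [c₁, …, cₙ]` is a weak chain `x < c₁ < ⋯ < cₙ = z` for `S`. -/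
def IsWord : P → List P → Prop
  | x, [] => x = z
  | x, c :: w => (S x c ∧ x ≠ c) ∧ IsWord c w

variable (S z) in
/-- Equivalence of words from `x` to `z`: the congruence generated by replacing `x < b < c` by
`x < c` whenever `S x c`. Its classes are the morphisms from `x` to `z` in the category generated by
`S`. -/
inductive WordEqv : P → List P → List P → Prop
  | nil : WordEqv z [] []
  | cons {x b u v} : S x b → x ≠ b → WordEqv b u v → WordEqv x (b :: u) (b :: v)
  | contract {x b c u} : S x b → x ≠ b → S b c → b ≠ c → S x c → IsWord S z c u →
      WordEqv x (b :: c :: u) (c :: u)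
  | symm {x u v} : WordEqv x u v → WordEqv x v u
  | trans {x u v w} : WordEqv x u v → WordEqv x v w → WordEqv x u w

theorem IsWord.eqv : ∀ {x : P} {w : List P}, IsWord S z x w → WordEqv S z x w w
  | x, [], h => by
    obtain rfl : x = z := h
    exact .nil
  | _, _ :: _, h => .cons h.1.1 h.1.2 h.2.eqv

theorem WordEqv.isWord (G : IsGarsideRel S φ) {x : P} {u v : List P} (h : WordEqv S z x u v) :
    IsWord S z x u ∧ IsWord S z x v := by
  induction h with
  | nil => exact ⟨rfl, rfl⟩
  | cons h1 h2 _ ih => exact ⟨⟨⟨h1, h2⟩, ih.1⟩, ⟨h1, h2⟩, ih.2⟩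
  | contract h1 h2 h3 h4 h5 h6 =>
    refine ⟨⟨⟨h1, h2⟩, ⟨h3, h4⟩, h6⟩, ⟨h5, ?_⟩, h6⟩
    rintro rfl
    exact h2 (G.antisymm h1 h3)
  | symm _ ih => exact ih.symm
  | trans _ _ ih1 ih2 => exact ⟨ih1.1, ih2.2⟩

theorem WordEqv.nil_iff {x : P} {u v : List P} (h : WordEqv S z x u v) : u = [] ↔ v = [] := by
  induction h with
  | nil => rfl
  | cons => simp
  | contract => simp
  | symm _ ih => exact ih.symm
  | trans _ _ ih1 ih2 => exact ih1.trans ih2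

open Classical in
/-- Composition of `S x a` with a word starting at `a`; the identity `S x x` is dropped. -/
noncomputable def scons (x a : P) (w : List P) : List P := if x = a then w else a :: w

theorem scons_self (x : P) (w : List P) : scons x x w = w := if_pos rfl

theorem scons_of_ne {x a : P} (h : x ≠ a) (w : List P) : scons x a w = a :: w := if_neg h

theorem IsWord.scons {x a : P} {w : List P} (h : S x a) (hw : IsWord S z a w) :
    IsWord S z x (scons x a w) := by
  by_cases hxa : x = a
  · subst hxa; rwa [scons_self]
  · rw [scons_of_ne hxa]; exact ⟨⟨h, hxa⟩, hw⟩

theorem WordEqv.scons {x a : P} {u v : List P} (h : S x a) (huv : WordEqv S z a u v) :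
    WordEqv S z x (scons x a u) (scons x a v) := by
  by_cases hxa : x = a
  · subst hxa; rwa [scons_self, scons_self]
  · rw [scons_of_ne hxa, scons_of_ne hxa]; exact .cons h hxa huv

theorem scons_scons_eqv (G : IsGarsideRel S φ) {x a b : P} {w : List P} (hxa : S x a)
    (hab : S a b) (hxb : S x b) (hw : IsWord S z b w) :
    WordEqv S z x (scons x a (scons a b w)) (scons x b w) := by
  by_cases h1 : x = a
  · subst h1
    rw [scons_self]
    exact (hw.scons hxb).eqv
  by_cases h2 : a = b
  · subst h2
    rw [scons_self]
    exact (hw.scons hxa).eqv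
  have h3 : x ≠ b := by
    rintro rfl
    exact h1 (G.antisymm hxa hab)
  rw [scons_of_ne h1, scons_of_ne h2, scons_of_ne h3]
  exact .contract hxa h1 hab h2 hxb hw

theorem IsWord.height_le {h : P → ℤ} (hh : ∀ a b, S a b → a ≠ b → h a < h b) :
    ∀ {x : P} {w : List P}, IsWord S z x w → h x ≤ h z
  | _, [], e => (congrArg h e).le
  | _, _ :: _, e => (hh _ _ e.1.1 e.1.2).le.trans (IsWord.height_le hh e.2)

/-- The conclusion of Garside's lemma for words starting at `x`: a common multiple of `a` and `b`
is a multiple of their local join. -/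
def GarsideProperty (S : P → P → Prop) (z x : P) : Prop :=
  ∀ a b f g j, S x a → S x b → WordEqv S z x (scons x a f) (scons x b g) →
    IsWord S z a f → IsWord S z b g → IsLocalJoin S x a b j →
    ∃ k, IsWord S z j k ∧ WordEqv S z a f (scons a j k) ∧ WordEqv S z b g (scons b j k)

/-- The inductive step of Garside's lemma. The claim holds for an elementary replacement, and it is
transitive: two local joins `a ∨ c` and `c ∨ b` are compared at the base point `c`. -/
theorem garsideProperty_step (G : IsGarsideRel S φ) {x : P}
    (ih : ∀ c, S x c → x ≠ c → ∀ w, IsWord S z c w → GarsideProperty S z c) {u v : List P}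
    (huv : WordEqv S z x u v) : ∀ a b f g j, u = a :: f → v = b :: g → IsLocalJoin S x a b j →
    ∃ k, IsWord S z j k ∧ WordEqv S z a f (scons a j k) ∧ WordEqv S z b g (scons b j k) := by
  induction huv with
  | nil => rintro a b f g j ⟨⟩
  | @cons x c u v h1 h2 h3 =>
    rintro a b f g j ⟨⟩ ⟨⟩ hj
    obtain rfl : j = c := G.antisymm (hj.least c h1 (G.refl c) (G.refl c)) hj.left
    refine ⟨u, (h3.isWord G).1, ?_, ?_⟩ <;> rw [scons_self]
    · exact (h3.isWord G).1.eqv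
    · exact h3.symm
  | @contract x a c u h1 h2 h3 h4 h5 h6 =>
    rintro a b f g j ⟨⟩ ⟨⟩ hj
    obtain rfl : j = c := G.antisymm (hj.least c h5 h3 (G.refl c)) hj.right
    refine ⟨u, h6, ?_, ?_⟩
    · rw [scons_of_ne h4]
      exact IsWord.eqv ⟨⟨h3, h4⟩, h6⟩
    · rw [scons_self]
      exact h6.eqv
  | symm _ ih' =>
    intro a b f g j hu hv hj
    obtain ⟨k, hk, h1, h2⟩ := ih' ih b a g f j hv hu ⟨hj.base, hj.right, hj.left,
      fun k hk h1 h2 => hj.least k hk h2 h1⟩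
    exact ⟨k, hk, h2, h1⟩
  | @trans x u w v huw hwv ih1 ih2 =>
    intro a b f g j hu hv hj
    obtain _ | ⟨c, m⟩ := w
    · rw [huw.nil_iff.mpr rfl] at hu
      cases hu
    subst hu hv
    obtain ⟨⟨⟨hxa, -⟩, hf⟩, ⟨⟨hxc, hxc'⟩, hm⟩⟩ := huw.isWord G
    obtain ⟨⟨hxb, -⟩, hg⟩ := (hwv.isWord G).2
    obtain ⟨j₁, hj₁⟩ := G.exists_join x a c hxa hxc
    obtain ⟨j₂, hj₂⟩ := G.exists_join x c b hxc hxb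
    obtain ⟨k₁, hk₁, hf₁, hm₁⟩ := ih1 ih a c f m j₁ rfl rfl hj₁
    obtain ⟨k₂, hk₂, hm₂, hg₂⟩ := ih2 ih c b m g j₂ rfl rfl hj₂
    obtain ⟨e, he⟩ := G.exists_join c j₁ j₂ hj₁.right hj₂.left
    obtain ⟨k₃, hk₃, hk₁₃, hk₂₃⟩ := ih c hxc hxc' m hm j₁ j₂ k₁ k₂ e hj₁.right hj₂.left
      (hm₁.symm.trans hm₂) hk₁ hk₂ he
    -- the join `e`, formed above `c`, stays below `φ x`, hence it is simple at `x`
    have heφ : S e (φ x) := he.least _ (G.right_apply _ _ hxc) (G.right_apply _ _ hj₁.base)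
      (G.right_apply _ _ hj₂.base)
    have hxe : S x e := G.trans_of_top hxc he.base heφ (G.right_apply _ _ hxc) (G.apply_right x)
    have hae : S a e := G.trans_of_base hxa hj₁.base hxe hj₁.left he.left
    have hbe : S b e := G.trans_of_base hxb hj₂.base hxe hj₂.right he.right
    have hje : S j e := hj.least e hxe hae hbe
    refine ⟨scons j e k₃, hk₃.scons hje, ?_, ?_⟩
    · exact ((hf₁.trans (hk₁₃.scons hj₁.left)).trans
        (scons_scons_eqv G hj₁.left he.left hae hk₃)).trans
        (scons_scons_eqv G hj.left hje hae hk₃).symm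
    · exact ((hg₂.trans (hk₂₃.scons hj₂.right)).trans
        (scons_scons_eqv G hj₂.right he.right hbe hk₃)).trans
        (scons_scons_eqv G hj.right hje hbe hk₃).symm

/-- Garside's lemma. The height function bounds the length of words and makes induction possible. -/
theorem garsideProperty (G : IsGarsideRel S φ) {h : P → ℤ}
    (hh : ∀ a b, S a b → a ≠ b → h a < h b) (x : P) : GarsideProperty S z x := by
  induction hn : (h z - h x).toNat using Nat.strong_induction_on generalizing x with
  | _ n IH =>
  have ih : ∀ c, S x c → x ≠ c → ∀ w, IsWord S z c w → GarsideProperty S z c := by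
    intro c hxc hne w hw
    have h1 := hh x c hxc hne
    have h2 := hw.height_le hh
    exact IH _ (by omega) c rfl
  intro a b f g j hxa hxb hfg hf hg hj
  by_cases ha : x = a
  · subst ha
    obtain rfl : j = b := G.antisymm (hj.least b hxb hxb (G.refl b)) hj.right
    rw [scons_self] at hfg
    exact ⟨g, hg, hfg, by rw [scons_self]; exact hg.eqv⟩
  by_cases hb : x = b
  · subst hb
    obtain rfl : j = a := G.antisymm (hj.least a hxa (G.refl a) hxa) hj.left
    rw [scons_self] at hfg
    exact ⟨f, hf, by rw [scons_self]; exact hf.eqv, hfg.symm⟩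
  rw [scons_of_ne ha, scons_of_ne hb] at hfg
  exact garsideProperty_step G ih hfg a b f g j rfl rfl hj

theorem WordEqv.left_cancel (G : IsGarsideRel S φ) {h : P → ℤ}
    (hh : ∀ a b, S a b → a ≠ b → h a < h b) {x a : P} {f g : List P} (hxa : S x a)
    (hf : IsWord S z a f) (hg : IsWord S z a g)
    (hfg : WordEqv S z x (_root_.scons x a f) (_root_.scons x a g)) : WordEqv S z a f g := by
  obtain ⟨k, -, h1, h2⟩ := garsideProperty G hh x a a f g a hxa hxa hfg hf hg
    ⟨hxa, G.refl a, G.refl a, fun _ _ h _ => h⟩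
  exact h1.trans h2.symm

end Words

/-! ### Uniqueness of morphisms -/

/-- A set `U` over `P`, via `start`, on which `S` acts on the left: if `S y (start u)`, then
`mul y u` is the composite of `S y (start u)` with `u`, and it starts at `y`. Otherwise the value of
`mul y u` is irrelevant. The action is cancellative. -/
structure CancelAction {P : Type*} (S : P → P → Prop) (U : Type*) where
  /-- the source of an element -/
  start : U → P
  /-- composition on the left with `S y (start u)` -/
  mul : P → U → U
  start_mul : ∀ y u, S y (start u) → start (mul y u) = y
  mul_mul : ∀ y z u, S y z → S z (start u) → S y (start u) → mul y (mul z u) = mul y u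
  mul_start : ∀ u, mul (start u) u = u
  cancel : ∀ y u v, S y (start u) → start u = start v → mul y u = mul y v → u = v

section Localization

variable {P : Type*} {S : P → P → Prop} {φ : Equiv.Perm P} {U : Type*}

namespace IsGarsideRel

variable (G : IsGarsideRel S φ)
include G

theorem symm_apply_left {a b : P} (h : S a b) : S (φ.symm b) a := by
  rw [← G.map_iff, φ.apply_symm_apply]
  exact G.right_apply a b h

theorem symm_map {a b : P} (h : S a b) : S (φ.symm a) (φ.symm b) := by
  rw [← G.map_iff, φ.apply_symm_apply, φ.apply_symm_apply]
  exact h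

theorem symm_iterate_map {a b : P} (h : S a b) (n : ℕ) : S (φ.symm^[n] a) (φ.symm^[n] b) := by
  induction n with
  | zero => exact h
  | succ n ih =>
    rw [Function.iterate_succ_apply', Function.iterate_succ_apply']
    exact G.symm_map ih

theorem iterate_map_iff {a b : P} (n : ℕ) : S (φ^[n] a) (φ^[n] b) ↔ S a b := by
  induction n with
  | zero => rfl
  | succ n ih => rw [Function.iterate_succ_apply', Function.iterate_succ_apply', G.map_iff, ih]

end IsGarsideRel

theorem symm_iterate_iterate (φ : Equiv.Perm P) (n : ℕ) (y : P) : φ.symm^[n] (φ^[n] y) = y :=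
  (φ.left_inv.iterate n) y

theorem iterate_symm_iterate (φ : Equiv.Perm P) (n : ℕ) (y : P) : φ^[n] (φ.symm^[n] y) = y :=
  (φ.right_inv.iterate n) y

namespace CancelAction

variable (A : CancelAction S U)

/-- Composition on the left with the Garside morphism from `φ⁻¹ x` to `x`. -/
def shift (φ : Equiv.Perm P) (u : U) : U := A.mul (φ.symm (A.start u)) u

variable {A} (G : IsGarsideRel S φ)
include G

theorem start_shift (u : U) : A.start (A.shift φ u) = φ.symm (A.start u) :=
  A.start_mul _ _ (G.symm_apply_left (G.refl _))

theorem start_iterate_shift (n : ℕ) (u : U) :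
    A.start ((A.shift φ)^[n] u) = φ.symm^[n] (A.start u) := by
  induction n with
  | zero => rfl
  | succ n ih =>
    rw [Function.iterate_succ_apply', Function.iterate_succ_apply', start_shift G, ih]

theorem shift_injective : Function.Injective (A.shift φ) := by
  intro u v h
  have h1 : A.start u = A.start v := by
    have := congrArg A.start h
    rwa [start_shift G, start_shift G, φ.symm.injective.eq_iff] at this
  refine A.cancel _ u v (G.symm_apply_left (G.refl _)) h1 ?_
  rw [shift, shift, ← h1] at h
  exact h

theorem shift_mul {y : P} {u : U} (h : S y (A.start u)) :
    A.shift φ (A.mul y u) = A.mul (φ.symm y) (A.shift φ u) := by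
  rw [shift, A.start_mul y u h]
  have h1 : S (φ.symm (A.start u)) y := G.symm_apply_left h
  have h2 : A.start (A.mul y u) = y := A.start_mul y u h
  rw [shift, ← A.mul_mul _ y u h1 h (G.symm_apply_left (G.refl _)),
    A.mul_mul (φ.symm y) (φ.symm (A.start u)) (A.mul y u) (G.symm_map h) (by rwa [h2])
      (by rw [h2]; exact G.symm_apply_left (G.refl _))]

theorem iterate_shift_mul (n : ℕ) {y : P} {u : U} (h : S y (A.start u)) :
    (A.shift φ)^[n] (A.mul y u) = A.mul (φ.symm^[n] y) ((A.shift φ)^[n] u) := by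
  induction n with
  | zero => rfl
  | succ n ih =>
    rw [Function.iterate_succ_apply', Function.iterate_succ_apply', Function.iterate_succ_apply',
      ih, shift_mul G]
    rw [start_iterate_shift G]
    exact G.symm_iterate_map h n

omit G

variable (A) in
/-- The pair `(n, u)` stands for the formal quotient of `u` by the `n`-th power of the Garside
morphism; two such quotients are compared over a common denominator. -/
def locSetoid (G : IsGarsideRel S φ) : Setoid (ℕ × U) where
  r p q := (A.shift φ)^[q.1] p.2 = (A.shift φ)^[p.1] q.2
  iseqv := by
    refine ⟨fun _ => rfl, fun h => Eq.symm h, ?_⟩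
    rintro ⟨n, u⟩ ⟨m, v⟩ ⟨k, w⟩ (h1 : _^[m] u = _^[n] v) (h2 : _^[k] v = _^[m] w)
    refine (shift_injective (A := A) G).iterate m ?_
    rw [← Function.iterate_add_apply, add_comm, Function.iterate_add_apply, h1,
      ← Function.iterate_add_apply, add_comm, Function.iterate_add_apply, h2,
      ← Function.iterate_add_apply, add_comm, Function.iterate_add_apply]

variable (A) in
/-- The localization of `U` at the Garside morphisms. -/
def Loc (G : IsGarsideRel S φ) : Type _ := Quotient (A.locSetoid G)

variable (A) in
/-- The fraction represented by `(n, u)`. -/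
def Loc.mk (G : IsGarsideRel S φ) (n : ℕ) (u : U) : A.Loc G := Quotient.mk (A.locSetoid G) (n, u)

theorem Loc.mk_eq {G : IsGarsideRel S φ} {n m : ℕ} {u v : U} :
    Loc.mk A G n u = Loc.mk A G m v ↔ (A.shift φ)^[m] u = (A.shift φ)^[n] v :=
  Quotient.eq (r := A.locSetoid G)

theorem Loc.mk_add_shift (G : IsGarsideRel S φ) (n m : ℕ) (u : U) :
    Loc.mk A G (n + m) ((A.shift φ)^[m] u) = Loc.mk A G n u := by
  rw [Loc.mk_eq, ← Function.iterate_add_apply]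

theorem Loc.exists_mk {G : IsGarsideRel S φ} (q : A.Loc G) : ∃ n u, q = Loc.mk A G n u := by
  induction q using Quotient.inductionOn with
  | h p => exact ⟨p.1, p.2, rfl⟩

theorem Loc.exists_mk₂ {G : IsGarsideRel S φ} (p q : A.Loc G) :
    ∃ n u v, p = Loc.mk A G n u ∧ q = Loc.mk A G n v := by
  obtain ⟨n, u, rfl⟩ := p.exists_mk
  obtain ⟨m, v, rfl⟩ := q.exists_mk
  exact ⟨n + m, _, _, (Loc.mk_add_shift G n m u).symm,
    (Loc.mk_add_shift G m n v).symm.trans (by rw [add_comm])⟩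

variable (A) in
/-- The source of a fraction. -/
def Loc.start (G : IsGarsideRel S φ) : A.Loc G → P :=
  Quotient.lift (fun p => φ^[p.1] (A.start p.2)) (by
    rintro ⟨n, u⟩ ⟨m, v⟩ (h : _^[m] u = _^[n] v)
    change φ^[n] (A.start u) = φ^[m] (A.start v)
    have h1 : ∀ k w, A.start w = φ^[k] (A.start ((A.shift φ)^[k] w)) := fun k w => by
      rw [start_iterate_shift G, iterate_symm_iterate]
    rw [h1 m u, h, h1 n v, ← Function.iterate_add_apply, add_comm, Function.iterate_add_apply])

open Classical in
variable (A) in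
/-- The action of `S` on fractions. -/
noncomputable def Loc.mul (G : IsGarsideRel S φ) (y : P) : A.Loc G → A.Loc G :=
  Quotient.lift (fun p => if S y (φ^[p.1] (A.start p.2)) then
      Loc.mk A G p.1 (A.mul (φ.symm^[p.1] y) p.2) else Loc.mk A G p.1 p.2) (by
    rintro ⟨n, u⟩ ⟨m, v⟩ (h : _^[m] u = _^[n] v)
    have h1 : φ^[n] (A.start u) = φ^[m] (A.start v) :=
      congrArg (Loc.start A G) (Loc.mk_eq.mpr h : Loc.mk A G n u = Loc.mk A G m v)
    have h3 : ∀ k w, S y (φ^[k] (A.start w)) → S (φ.symm^[k] y) (A.start w) := fun k w hw => by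
      rwa [← G.iterate_map_iff k, iterate_symm_iterate]
    dsimp only
    by_cases h2 : S y (φ^[n] (A.start u))
    · rw [if_pos h2, if_pos (h1 ▸ h2), Loc.mk_eq, iterate_shift_mul G _ (h3 _ _ h2),
        iterate_shift_mul G _ (h3 _ _ (h1 ▸ h2)), h, ← Function.iterate_add_apply,
        ← Function.iterate_add_apply, add_comm]
    · rw [if_neg h2, if_neg (h1 ▸ h2), Loc.mk_eq]
      exact h)

theorem Loc.start_mk (G : IsGarsideRel S φ) (n : ℕ) (u : U) :
    Loc.start A G (Loc.mk A G n u) = φ^[n] (A.start u) := rfl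

theorem Loc.mul_mk (G : IsGarsideRel S φ) {y : P} {n : ℕ} {u : U}
    (h : S y (φ^[n] (A.start u))) :
    Loc.mul A G y (Loc.mk A G n u) = Loc.mk A G n (A.mul (φ.symm^[n] y) u) :=
  if_pos h

theorem base_of_iterate (G : IsGarsideRel S φ) {y x : P} {n : ℕ} (h : S y (φ^[n] x)) :
    S (φ.symm^[n] y) x := by
  rwa [← G.iterate_map_iff n, iterate_symm_iterate]

variable (A) in
/-- The localization carries a cancellative action of `S` again. -/
noncomputable def locAction (G : IsGarsideRel S φ) : CancelAction S (A.Loc G) where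
  start := Loc.start A G
  mul := Loc.mul A G
  start_mul y q h := by
    obtain ⟨n, u, rfl⟩ := q.exists_mk
    rw [Loc.start_mk] at h
    rw [Loc.mul_mk G h, Loc.start_mk, A.start_mul _ _ (base_of_iterate G h), iterate_symm_iterate]
  mul_mul y z q h1 h2 h3 := by
    obtain ⟨n, u, rfl⟩ := q.exists_mk
    rw [Loc.start_mk] at h2 h3
    have h4 := A.start_mul _ _ (base_of_iterate G h2)
    rw [Loc.mul_mk G h2, Loc.mul_mk G h3, Loc.mul_mk G (by rwa [h4, iterate_symm_iterate]),
      A.mul_mul _ _ _ (G.symm_iterate_map h1 n) (base_of_iterate G h2) (base_of_iterate G h3)]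
  mul_start q := by
    obtain ⟨n, u, rfl⟩ := q.exists_mk
    rw [Loc.start_mk, Loc.mul_mk G (G.refl _), symm_iterate_iterate, A.mul_start]
  cancel y p q h1 h2 h3 := by
    obtain ⟨n, u, v, rfl, rfl⟩ := Loc.exists_mk₂ p q
    rw [Loc.start_mk] at h1
    rw [Loc.start_mk, Loc.start_mk, (φ.injective.iterate n).eq_iff] at h2
    rw [Loc.mul_mk G h1, Loc.mul_mk G (h2 ▸ h1), Loc.mk_eq,
      ((shift_injective (A := A) G).iterate n).eq_iff] at h3
    rw [A.cancel _ u v (base_of_iterate G h1) h2 h3]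

theorem locAction_start (G : IsGarsideRel S φ) (q : A.Loc G) :
    (A.locAction G).start q = Loc.start A G q := rfl

theorem locAction_mul (G : IsGarsideRel S φ) (y : P) (q : A.Loc G) :
    (A.locAction G).mul y q = Loc.mul A G y q := rfl

/-- In the localization, `S` acts by bijections between the fibres: `y ≤ z ≤ φ y`, so that every
element over `y` is divisible by `S y z`. -/
theorem exists_mul_eq (G : IsGarsideRel S φ) (z : P) (q : A.Loc G)
    (h : S ((A.locAction G).start q) z) : ∃ p, (A.locAction G).start p = z ∧
      (A.locAction G).mul ((A.locAction G).start q) p = q := by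
  obtain ⟨n, u, rfl⟩ := q.exists_mk
  set x := A.start u with hx
  set y := φ^[n] x with hy
  change S y z at h
  have hxy : φ.symm^[n] y = x := symm_iterate_iterate φ n x
  have hz : S (φ.symm^[n + 1] z) x := by
    rw [Function.iterate_succ_apply', ← hxy]
    exact G.symm_apply_left (G.symm_iterate_map h n)
  have hs : (A.locAction G).start (Loc.mk A G (n + 1) (A.mul (φ.symm^[n + 1] z) u)) = z := by
    rw [locAction_start, Loc.start_mk, A.start_mul _ _ hz, iterate_symm_iterate]
  refine ⟨_, hs, ?_⟩
  have h1 : S (φ.symm^[n + 1] y) (φ.symm^[n + 1] z) := G.symm_iterate_map h _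
  have h2 : φ.symm^[n + 1] y = φ.symm x := by
    rw [Function.iterate_succ_apply', hxy]
  rw [locAction_start, locAction_mul, Loc.start_mk, ← hx, ← hy,
    Loc.mul_mk G (by rwa [A.start_mul _ _ hz, iterate_symm_iterate]),
    A.mul_mul _ _ _ h1 hz (h2 ▸ G.symm_apply_left (G.refl x)), h2]
  exact Loc.mk_add_shift G n 1 u

end CancelAction

end Localization

section GlobalSection

variable {P : Type*} {S : P → P → Prop} {φ : Equiv.Perm P} {U : Type*}

/-- An action of `S` by bijections has a global section through every element, as soon as cocycles
on `S` with values in groups of permutations are coboundaries. -/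
theorem CancelAction.exists_section (A : CancelAction S U)
    (hconn : ∀ u v, Relation.EqvGen S u v)
    (hsurj : ∀ z q, S (A.start q) z → ∃ p, A.start p = z ∧ A.mul (A.start q) p = q) (q₀ : U)
    (hcob : ∀ c : P → P → Equiv.Perm {q // A.start q = A.start q₀},
      (∀ u v w, S u v → S v w → S u w → c u v * c v w = c u w) →
      ∃ h : P → Equiv.Perm {q // A.start q = A.start q₀},
        ∀ u v, S u v → c u v = (h u)⁻¹ * h v) :
    ∃ σ : P → U, (∀ y, A.start (σ y) = y) ∧ σ (A.start q₀) = q₀ ∧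
      ∀ u v, S u v → A.mul u (σ v) = σ u := by
  classical
  set x := A.start q₀ with hx
  have hbij : ∀ u v (h : S u v), Function.Bijective
      (fun q : {q // A.start q = v} =>
        (⟨A.mul u q.1, A.start_mul u q.1 (by rw [q.2]; exact h)⟩ : {q // A.start q = u})) := by
    intro u v h
    refine ⟨fun p q hpq => Subtype.ext (A.cancel u p.1 q.1 (by rw [p.2]; exact h)
      (p.2.trans q.2.symm) (congrArg Subtype.val hpq)), fun q => ?_⟩
    obtain ⟨p, hp, hpq⟩ := hsurj v q.1 (by rw [q.2]; exact h)
    refine ⟨⟨p, hp⟩, Subtype.ext ?_⟩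
    change A.mul u p = q.1
    have := q.2
    rw [← hpq, this]
  let e : ∀ u v, S u v → ({q // A.start q = v} ≃ {q // A.start q = u}) := fun u v h =>
    Equiv.ofBijective _ (hbij u v h)
  have hne : ∀ y, Nonempty ({q // A.start q = x} ≃ {q // A.start q = y}) := by
    have : ∀ u v, Relation.EqvGen S u v →
        Nonempty ({q // A.start q = u} ≃ {q // A.start q = v}) := by
      intro u v h
      induction h with
      | rel u v h => exact ⟨(e u v h).symm⟩
      | refl => exact ⟨Equiv.refl _⟩
      | symm _ _ _ ih => exact ⟨ih.some.symm⟩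
      | trans _ _ _ _ _ ih1 ih2 => exact ⟨ih1.some.trans ih2.some⟩
    exact fun y => this x y (hconn x y)
  let B : ∀ y, {q // A.start q = x} ≃ {q // A.start q = y} := fun y => (hne y).some
  let c : P → P → Equiv.Perm {q // A.start q = x} := fun u v =>
    if h : S u v then ((B v).trans (e u v h)).trans (B u).symm else 1
  have hc : ∀ u v (h : S u v) q, B u (c u v q) = e u v h (B v q) := by
    intro u v h q
    simp only [c, dif_pos h, Equiv.trans_apply, Equiv.apply_symm_apply]
  obtain ⟨k, hk⟩ := hcob c fun u v w huv hvw huw => by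
    ext1 q
    refine (B u).injective (Subtype.ext ?_)
    rw [Equiv.Perm.mul_apply, hc u v huv, hc v w hvw, hc u w huw]
    exact A.mul_mul u v _ huv (by rw [(B w q).2]; exact hvw) (by rw [(B w q).2]; exact huw)
  let q₁ : {q // A.start q = x} := k x ((B x).symm ⟨q₀, rfl⟩)
  refine ⟨fun y => (B y ((k y)⁻¹ q₁)).1, fun y => (B y ((k y)⁻¹ q₁)).2, ?_, fun u v h => ?_⟩
  · simp [q₁]
  · have := hc u v h ((k v)⁻¹ q₁)
    rw [hk u v h, ← Equiv.Perm.mul_apply, mul_inv_cancel_right] at this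
    exact (congrArg Subtype.val this).symm

end GlobalSection

section Uniqueness

variable {P : Type*} {S : P → P → Prop} {φ : Equiv.Perm P}

/-- Equivalence of words ending at `z`, with arbitrary source. -/
def wordSetoid (S : P → P → Prop) (z : P) :
    Setoid {p : P × List P // IsWord S z p.1 p.2} where
  r p q := p.1.1 = q.1.1 ∧ WordEqv S z p.1.1 p.1.2 q.1.2
  iseqv := by
    refine ⟨fun p => ⟨rfl, p.2.eqv⟩, fun {p q} h => ⟨h.1.symm, h.1 ▸ h.2.symm⟩,
      fun {p q r} h1 h2 => ⟨h1.1.trans h2.1, h1.2.trans (h1.1 ▸ h2.2)⟩⟩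

/-- The morphisms with target `z` of the category generated by `S`. -/
def WordClass (S : P → P → Prop) (z : P) : Type _ := Quotient (wordSetoid S z)

/-- The morphism represented by a word. -/
def WordClass.mk {z x : P} {w : List P} (hw : IsWord S z x w) : WordClass S z :=
  Quotient.mk (wordSetoid S z) ⟨(x, w), hw⟩

theorem WordClass.exists_mk {z : P} (q : WordClass S z) :
    ∃ (x : P) (w : List P) (hw : IsWord S z x w), q = WordClass.mk hw := by
  induction q using Quotient.inductionOn with
  | h p => exact ⟨p.1.1, p.1.2, p.2, rfl⟩

theorem WordClass.mk_eq {z x : P} {v w : List P} {hv : IsWord S z x v} {hw : IsWord S z x w} :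
    WordClass.mk hv = WordClass.mk hw ↔ WordEqv S z x v w :=
  (Quotient.eq (r := wordSetoid S z)).trans ⟨fun h => h.2, fun h => ⟨rfl, h⟩⟩

/-- The source of a morphism. -/
def WordClass.start {z : P} : WordClass S z → P :=
  Quotient.lift (fun p => p.1.1) fun _ _ h => h.1

open Classical in
/-- Composition on the left with a simple morphism. -/
noncomputable def WordClass.mul {z : P} (y : P) : WordClass S z → WordClass S z :=
  Quotient.lift
    (fun p => if h : S y p.1.1 then WordClass.mk (p.2.scons h) else WordClass.mk p.2) (by
      rintro ⟨⟨x, v⟩, hv⟩ ⟨⟨x', w⟩, hw⟩ ⟨rfl : x = x', h⟩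
      dsimp only
      split_ifs with hy
      · exact WordClass.mk_eq.mpr (h.scons hy)
      · exact WordClass.mk_eq.mpr h)

theorem WordClass.mul_mk {z x y : P} {w : List P} (hw : IsWord S z x w) (h : S y x) :
    WordClass.mul y (WordClass.mk hw) = WordClass.mk (hw.scons h) :=
  dif_pos h

/-- The action of simple morphisms on the morphisms with target `z`, which is cancellative by
Garside's lemma. -/
noncomputable def wordAction (G : IsGarsideRel S φ) {h : P → ℤ}
    (hh : ∀ a b, S a b → a ≠ b → h a < h b) (z : P) : CancelAction S (WordClass S z) where
  start := WordClass.start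
  mul := WordClass.mul
  start_mul y q hy := by
    obtain ⟨x, w, hw, rfl⟩ := q.exists_mk
    rw [WordClass.mul_mk hw hy]
    rfl
  mul_mul y x q h1 h2 h3 := by
    obtain ⟨x', w, hw, rfl⟩ := q.exists_mk
    rw [WordClass.mul_mk hw h2, WordClass.mul_mk _ h1, WordClass.mul_mk hw h3, WordClass.mk_eq]
    exact scons_scons_eqv G h1 h2 h3 hw
  mul_start q := by
    obtain ⟨x, w, hw, rfl⟩ := q.exists_mk
    change WordClass.mul x _ = _
    rw [WordClass.mul_mk hw (G.refl x), WordClass.mk_eq, scons_self]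
    exact hw.eqv
  cancel y p q h1 h2 h3 := by
    obtain ⟨x, v, hv, rfl⟩ := p.exists_mk
    obtain ⟨x', w, hw, rfl⟩ := q.exists_mk
    obtain rfl : x = x' := h2
    have hy : S y x := h1
    rw [WordClass.mul_mk hv hy, WordClass.mul_mk hw hy, WordClass.mk_eq] at h3
    exact WordClass.mk_eq.mpr (h3.left_cancel G hh hy hv hw)

/-- If permutation-valued cocycles on `S` are coboundaries, then any two words from `x` to `z` are
equivalent: a global section of the localized action takes at `x` the value of each of them. -/
theorem wordEqv_of_isWord.{u} {P : Type u} {S : P → P → Prop} {φ : Equiv.Perm P}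
    (G : IsGarsideRel S φ) {h : P → ℤ}
    (hh : ∀ a b, S a b → a ≠ b → h a < h b) (hconn : ∀ u v, Relation.EqvGen S u v)
    (hcob : ∀ (F : Type u) (c : P → P → Equiv.Perm F),
      (∀ u v w, S u v → S v w → S u w → c u v * c v w = c u w) →
      ∃ k : P → Equiv.Perm F, ∀ u v, S u v → c u v = (k u)⁻¹ * k v)
    {x z : P} {v w : List P} (hv : IsWord S z x v) (hw : IsWord S z x w) :
    WordEqv S z x v w := by
  let A := wordAction G hh z
  have hz : IsWord S z z [] := rfl
  obtain ⟨σ, -, hσz, hσ⟩ := (A.locAction G).exists_section hconn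
    (fun y q => A.exists_mul_eq G y q) (CancelAction.Loc.mk A G 0 (WordClass.mk hz))
    (fun c hc => hcob _ c hc)
  have key : ∀ (w : List P) (x : P) (hw : IsWord S z x w),
      σ x = CancelAction.Loc.mk A G 0 (WordClass.mk hw) := by
    intro w
    induction w with
    | nil =>
      intro x hw
      obtain rfl : x = z := hw
      exact hσz
    | cons b w ih =>
      intro x hw
      rw [← hσ x b hw.1.1, ih b hw.2]
      have h1 : (A.locAction G).mul x (CancelAction.Loc.mk A G 0 (WordClass.mk hw.2)) =
          CancelAction.Loc.mk A G 0 (A.mul x (WordClass.mk hw.2)) :=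
        CancelAction.Loc.mul_mk G (n := 0) (u := WordClass.mk hw.2) hw.1.1
      have h2 : A.mul x (WordClass.mk hw.2) = WordClass.mk (hw.2.scons hw.1.1) :=
        WordClass.mul_mk hw.2 hw.1.1
      rw [h1, h2]
      congr 1
      rw [WordClass.mk_eq, scons_of_ne hw.1.2]
      exact hw.eqv
  have h1 := (key v x hv).symm.trans (key w x hw)
  rw [CancelAction.Loc.mk_eq] at h1
  exact WordClass.mk_eq.mp h1

end Uniqueness

/-! ### The order generated by a Garside relation -/

section Order

variable {P : Type*} {S : P → P → Prop} {φ : Equiv.Perm P}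

theorem exists_isWord_of_weakChainRel {x z : P} (h : WeakChainRel S x z) :
    ∃ w, IsWord S z x w := by
  induction h using Relation.ReflTransGen.head_induction_on with
  | refl => exact ⟨[], rfl⟩
  | head h _ ih =>
    obtain ⟨w, hw⟩ := ih
    exact ⟨_ :: w, h, hw⟩

theorem IsWord.weakChainRel {z : P} : ∀ {x : P} {w : List P}, IsWord S z x w → WeakChainRel S x z
  | x, [], h => by
    obtain rfl : x = z := h
    exact .refl
  | _, _ :: _, h => (IsWord.weakChainRel h.2).head h.1

theorem weakChainRel_of_rel {a b : P} (h : S a b) : WeakChainRel S a b := by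
  by_cases hab : a = b
  · exact hab ▸ .refl
  · exact .single ⟨h, hab⟩

theorem height_le_of_weakChainRel {h : P → ℤ} (hh : ∀ a b, S a b → a ≠ b → h a < h b) {a b : P}
    (hab : WeakChainRel S a b) : h a ≤ h b := by
  obtain ⟨w, hw⟩ := exists_isWord_of_weakChainRel hab
  exact hw.height_le hh

theorem height_lt_of_weakChainRel {h : P → ℤ} (hh : ∀ a b, S a b → a ≠ b → h a < h b) {a b : P}
    (hab : WeakChainRel S a b) (hne : a ≠ b) : h a < h b := by
  rcases hab.cases_head with rfl | ⟨c, hac, hcb⟩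
  · exact absurd rfl hne
  · exact (hh a c hac.1 hac.2).trans_le (height_le_of_weakChainRel hh hcb)

theorem isPartialOrder_weakChainRel {h : P → ℤ} (hh : ∀ a b, S a b → a ≠ b → h a < h b) :
    IsPartialOrder P (WeakChainRel S) where
  refl _ := .refl
  trans _ _ _ h1 h2 := h1.trans h2
  antisymm a b h1 h2 := by
    by_contra hne
    exact (height_lt_of_weakChainRel hh h1 hne).not_ge (height_le_of_weakChainRel hh h2)

variable (G : IsGarsideRel S φ) {h : P → ℤ} (hh : ∀ a b, S a b → a ≠ b → h a < h b)
  (huniq : ∀ {x z : P} {v w : List P}, IsWord S z x v → IsWord S z x w → WordEqv S z x v w)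
include G hh huniq

/-- Local joins are joins for the generated order. -/
theorem IsLocalJoin.weakChainRel_of_le {x a b j y : P} (hj : IsLocalJoin S x a b j) (hxa : S x a)
    (hxb : S x b) (hay : WeakChainRel S a y) (hby : WeakChainRel S b y) : WeakChainRel S j y := by
  obtain ⟨f, hf⟩ := exists_isWord_of_weakChainRel hay
  obtain ⟨g, hg⟩ := exists_isWord_of_weakChainRel hby
  obtain ⟨k, hk, -⟩ := garsideProperty G hh x a b f g j hxa hxb
    (huniq (hf.scons hxa) (hg.scons hxb)) hf hg hj
  exact hk.weakChainRel

theorem exists_isJoin_of_rel {x b : P} (hxb : WeakChainRel S x b) :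
    ∀ a, S x a → ∃ z, IsJoin (WeakChainRel S) {a, b} z ∧ S b z := by
  induction hxb using Relation.ReflTransGen.head_induction_on with
  | refl =>
    intro a ha
    refine ⟨a, ⟨?_, fun y hy => hy a (by simp)⟩, ha⟩
    rintro s (rfl | rfl)
    exacts [.refl, weakChainRel_of_rel ha]
  | @head x c hxc hcb ih =>
    intro a ha
    obtain ⟨j, hj⟩ := G.exists_join x a c ha hxc.1
    obtain ⟨z, ⟨hz, hz'⟩, hbz⟩ := ih j hj.right
    refine ⟨z, ⟨?_, fun y hy => hz' y ?_⟩, hbz⟩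
    · rintro s (rfl | rfl)
      · exact (weakChainRel_of_rel hj.left).trans (hz j (by simp))
      · exact hz _ (by simp)
    · have hby := hy b (by simp)
      rintro s (rfl | rfl)
      · exact hj.weakChainRel_of_le G hh huniq ha hxc.1 (hy a (by simp)) (hcb.trans hby)
      · exact hby

theorem exists_isJoin_of_base {x a : P} (hxa : WeakChainRel S x a) :
    ∀ b, WeakChainRel S x b → ∃ z, IsJoin (WeakChainRel S) {a, b} z := by
  induction hxa using Relation.ReflTransGen.head_induction_on with
  | refl =>
    intro b hb
    refine ⟨b, ?_, fun y hy => hy b (by simp)⟩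
    rintro s (rfl | rfl)
    exacts [hb, .refl]
  | @head x c hxc hca ih =>
    intro b hb
    obtain ⟨j, ⟨hj, hj'⟩, -⟩ := exists_isJoin_of_rel G hh huniq hb c hxc.1
    obtain ⟨z, hz, hz'⟩ := ih j (hj c (by simp))
    refine ⟨z, ?_, fun y hy => hz' y ?_⟩
    · rintro s (rfl | rfl)
      · exact hz _ (by simp)
      · exact (hj _ (by simp)).trans (hz j (by simp))
    · have hay := hy a (by simp)
      rintro s (rfl | rfl)
      · exact hay
      · refine hj' y ?_
        rintro s (rfl | rfl)
        exacts [hca.trans hay, hy _ (by simp)]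

/-- Everything between `x` and `φ x` is simple at `x`. -/
theorem rel_of_weakChainRel_apply {x y : P} (hxy : WeakChainRel S x y)
    (hy : WeakChainRel S y (φ x)) : S x y := by
  induction hxy with
  | refl => exact G.refl x
  | @tail c y hxc hcy ih =>
    have hxc : S x c := ih (hy.head hcy)
    have hcφ : S c (φ x) := G.right_apply x c hxc
    obtain ⟨j, hj⟩ := G.exists_join c y (φ x) hcy.1 hcφ
    have hjφ := hj.weakChainRel_of_le G hh huniq hcy.1 hcφ hy .refl
    obtain rfl : j = φ x := (isPartialOrder_weakChainRel hh).antisymm _ _ hjφ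
      (weakChainRel_of_rel hj.right)
    exact G.trans_of_top hxc hcy.1 hj.left hcφ (G.apply_right x)

omit huniq hh in
theorem weakChainRel_map {a b : P} (hab : WeakChainRel S a b) : WeakChainRel S (φ a) (φ b) :=
  hab.lift φ fun _ _ h => ⟨(G.map_iff _ _).mpr h.1, φ.injective.ne h.2⟩

omit huniq hh in
theorem weakChainRel_iterate_map {a b : P} (hab : WeakChainRel S a b) (n : ℕ) :
    WeakChainRel S (φ^[n] a) (φ^[n] b) := by
  induction n with
  | zero => exact hab
  | succ n ih =>
    rw [Function.iterate_succ_apply', Function.iterate_succ_apply']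
    exact weakChainRel_map G ih

omit huniq hh in
theorem weakChainRel_symm_iterate (a : P) (n : ℕ) : WeakChainRel S (φ.symm^[n] a) a := by
  induction n with
  | zero => exact .refl
  | succ n ih =>
    rw [Function.iterate_succ_apply']
    exact (weakChainRel_of_rel (G.symm_apply_left (G.refl _))).trans ih

omit huniq hh in
/-- If `P` is connected, then the powers of `φ` move every element above every other one. -/
theorem exists_weakChainRel_iterate {a b : P} (hab : Relation.EqvGen S a b) :
    (∃ n, WeakChainRel S a (φ^[n] b)) ∧ ∃ n, WeakChainRel S b (φ^[n] a) := by
  have key : ∀ {a b c : P}, (∃ n, WeakChainRel S a (φ^[n] b)) →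
      (∃ n, WeakChainRel S b (φ^[n] c)) → ∃ n, WeakChainRel S a (φ^[n] c) := by
    rintro a b c ⟨n, hn⟩ ⟨m, hm⟩
    refine ⟨n + m, hn.trans ?_⟩
    rw [Function.iterate_add_apply]
    exact weakChainRel_iterate_map G hm n
  induction hab with
  | rel a b h =>
    exact ⟨⟨0, weakChainRel_of_rel h⟩, ⟨1, weakChainRel_of_rel (G.right_apply a b h)⟩⟩
  | refl => exact ⟨⟨0, .refl⟩, ⟨0, .refl⟩⟩
  | symm _ _ _ ih => exact ih.symm
  | trans _ _ _ _ _ ih1 ih2 => exact ⟨key ih1.1 ih2.1, key ih2.2 ih1.2⟩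

omit huniq hh in
theorem exists_common_lower_bound {a b : P} (hab : Relation.EqvGen S a b) :
    ∃ x, WeakChainRel S x a ∧ WeakChainRel S x b := by
  obtain ⟨n, hn⟩ := (exists_weakChainRel_iterate G hab).1
  refine ⟨φ.symm^[n] a, weakChainRel_symm_iterate G a n, ?_⟩
  have h1 : WeakChainRel S (φ.symm^[n] a) (φ.symm^[n] (φ^[n] b)) :=
    hn.lift φ.symm^[n] fun _ _ h =>
      ⟨G.symm_iterate_map h.1 n, (φ.symm.injective.iterate n).ne h.2⟩
  rwa [symm_iterate_iterate] at h1

theorem exists_isJoin_weakChainRel (hconn : ∀ u v, Relation.EqvGen S u v) (a b : P) :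
    ∃ z, IsJoin (WeakChainRel S) {a, b} z := by
  obtain ⟨x, hxa, hxb⟩ := exists_common_lower_bound G (hconn a b)
  exact exists_isJoin_of_base G hh huniq hxa b hxb

/-- A common lower bound of maximal height is the meet. -/
theorem exists_isMeet_weakChainRel (hconn : ∀ u v, Relation.EqvGen S u v) (a b : P) :
    ∃ z, IsMeet (WeakChainRel S) {a, b} z := by
  obtain ⟨x, hxa, hxb⟩ := exists_common_lower_bound G (hconn a b)
  -- heights of lower bounds are bounded by `h a`
  obtain ⟨m, ⟨z, hza, hzb, rfl⟩, hm⟩ := Int.exists_greatest_of_bdd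
    (P := fun m => ∃ z, WeakChainRel S z a ∧ WeakChainRel S z b ∧ h z = m)
    ⟨h a, by rintro _ ⟨z, hz, -, rfl⟩; exact height_le_of_weakChainRel hh hz⟩
    ⟨_, x, hxa, hxb, rfl⟩
  refine ⟨z, ?_, fun y hy => ?_⟩
  · rintro s (rfl | rfl)
    exacts [hza, hzb]
  · obtain ⟨j, hj, hj'⟩ := exists_isJoin_weakChainRel G hh huniq hconn y z
    have hja : WeakChainRel S j a := hj' a (by rintro s (rfl | rfl); exacts [hy _ (by simp), hza])
    have hjb : WeakChainRel S j b := hj' b (by rintro s (rfl | rfl); exacts [hy _ (by simp), hzb])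
    have hzj : z = j := by
      by_contra hne
      exact (height_lt_of_weakChainRel hh (hj z (by simp)) hne).not_ge (hm _ ⟨j, hja, hjb, rfl⟩)
    exact hzj ▸ hj y (by simp)

end Order

section Subposets

variable {P : Type*} {r : P → P → Prop}

/-- A subset of a lattice that is closed under joins and meets is a lattice. -/
theorem isLatticeRel_subrel (hr : IsPartialOrder P r) (p : P → Prop)
    (hjoin : ∀ a b, p a → p b → ∃ z, IsJoin r {a, b} z ∧ p z)
    (hmeet : ∀ a b, p a → p b → ∃ z, IsMeet r {a, b} z ∧ p z) : IsLatticeRel (Subrel r p) where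
  isPartialOrder :=
    { refl := fun a => hr.refl a.1
      trans := fun a b c h1 h2 => hr.trans a.1 b.1 c.1 h1 h2
      antisymm := fun a b h1 h2 => Subtype.ext (hr.antisymm a.1 b.1 h1 h2) }
  exists_join a b := by
    obtain ⟨z, ⟨h1, h2⟩, hz⟩ := hjoin a b a.2 b.2
    refine ⟨⟨z, hz⟩, ?_, fun y hy => h2 y ?_⟩
    · rintro s (rfl | rfl)
      exacts [h1 _ (by simp), h1 _ (by simp)]
    · rintro s (rfl | rfl)
      exacts [hy a (by simp), hy b (by simp)]
  exists_meet a b := by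
    obtain ⟨z, ⟨h1, h2⟩, hz⟩ := hmeet a b a.2 b.2
    refine ⟨⟨z, hz⟩, ?_, fun y hy => h2 y ?_⟩
    · rintro s (rfl | rfl)
      exacts [h1 _ (by simp), h1 _ (by simp)]
    · rintro s (rfl | rfl)
      exacts [hy a (by simp), hy b (by simp)]

/-- A strictly monotone integer-valued function makes every subset of a poset homogeneous. -/
theorem isHomogeneous_subrel {h : P → ℤ} (hlt : ∀ a b, r a b → a ≠ b → h a < h b)
    (p : P → Prop) : IsHomogeneous (Subrel r p) := by
  have hle : ∀ a b, r a b → h a ≤ h b := fun a b hab => by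
    by_cases e : a = b
    · exact e ▸ le_rfl
    · exact (hlt a b hab e).le
  refine ⟨fun a b => (h b - h a).toNat, fun a b c ⟨h1, h2, _⟩ => ?_, fun a b hab => ?_⟩
  · have := hle a b h1
    have := hle b c h2
    dsimp only
    omega
  · constructor
    · intro (e : (h b - h a).toNat = 0)
      by_contra hne
      have := hlt a b hab (fun e => hne (Subtype.ext e))
      omega
    · rintro rfl
      simp

end Subposets

/-! ### Contractibility for a lattice with an automorphism -/

section Cut

/-- The length of the part of `(-∞, y]` lying in `[k, k + 1]`. -/
noncomputable def cut (y : ℝ) (k : ℤ) : ℝ := min y (k + 1) - min y k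

theorem cut_of_le {y : ℝ} {k : ℤ} (h : y ≤ k) : cut y k = 0 := by
  rw [cut, min_eq_left h, min_eq_left (by linarith), sub_self]

theorem cut_of_ge {y : ℝ} {k : ℤ} (h : (k : ℝ) + 1 ≤ y) : cut y k = 1 := by
  rw [cut, min_eq_right h, min_eq_right (by linarith), add_sub_cancel_left]

theorem cut_mono {y y' : ℝ} (h : y ≤ y') (k : ℤ) : cut y k ≤ cut y' k := by
  rw [cut, cut]
  rcases le_total y k with h1 | h1
  · rw [min_eq_left h1, min_eq_left (by linarith)]
    have : min y' (k : ℝ) ≤ min y' (k + 1) := min_le_min_left _ (by linarith)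
    linarith
  · rw [min_eq_right h1, min_eq_right (h1.trans h)]
    have : min y ((k : ℝ) + 1) ≤ min y' (k + 1) := min_le_min_right _ h
    linarith

theorem continuous_cut (k : ℤ) : Continuous fun y => cut y k := by
  unfold cut
  fun_prop

theorem sum_cut {y : ℝ} {a b : ℤ} (hab : a ≤ b) (ha : (a : ℝ) ≤ y) (hb : y ≤ b) :
    ∑ k ∈ Finset.Ico a b, cut y k = y - a := by
  have key : ∀ b, a ≤ b → ∑ k ∈ Finset.Ico a b, cut y k = min y b - min y a := by
    intro b hab
    induction b, hab using Int.leInduction with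
    | base => simp
    | succ b hab ih =>
      rw [← Finset.insert_Ico_right_eq_Ico_add_one hab, Finset.sum_insert (by simp), ih, cut]
      push_cast
      ring
  rw [key b hab, min_eq_left hb, min_eq_right ha]

end Cut

section Push

variable {P : Type*} [Lattice P]

open Classical in
/-- The total weight strictly below `c`. -/
noncomputable def lowerWeight (q : P → ℝ) (c : P) : ℝ := ∑ᶠ d, if d < c then q d else 0

/-- A point `q` of the simplex on a chain is read as the step function on `[0, 1)` with value `c` on
the interval from `lowerWeight q c` to `lowerWeight q c + q c`. The number `stepWeight q σ c k` is
the length of the intersection of this interval with `[σ + k, σ + k + 1)`. -/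
noncomputable def stepWeight (q : P → ℝ) (σ : ℝ) (c : P) (k : ℤ) : ℝ :=
  cut (lowerWeight q c + q c - σ) k - cut (lowerWeight q c - σ) k

open Classical in
/-- The image of the step function of `q` under the map with value `f c k` where `q` has the value
`c` and the argument lies in `[σ + k, σ + k + 1)`, as a family of barycentric coordinates. -/
noncomputable def pushWeight (f : P → ℤ → P) (q : P → ℝ) (σ : ℝ) (v : P) : ℝ :=
  ∑ᶠ a : P × ℤ, if f a.1 a.2 = v then stepWeight q σ a.1 a.2 else 0

variable {s : Finset P} {q : P → ℝ}

open Classical in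
theorem lowerWeight_eq (hq : q ∈ closedSimplex s) (c : P) :
    lowerWeight q c = ∑ d ∈ s, if d < c then q d else 0 := by
  refine finsum_eq_sum_of_support_subset _ fun d hd => ?_
  by_contra hds
  exact hd (by simp [hq.2.1 d hds])

theorem lowerWeight_nonneg (hq : q ∈ closedSimplex s) (c : P) : 0 ≤ lowerWeight q c := by
  classical
  rw [lowerWeight_eq hq]
  refine Finset.sum_nonneg fun d _ => ?_
  split_ifs
  exacts [hq.1 d, le_rfl]

theorem lowerWeight_add_le_one (hq : q ∈ closedSimplex s) (c : P) :
    lowerWeight q c + q c ≤ 1 := by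
  classical
  have h1 : q c = ∑ d ∈ s, if d = c then q d else 0 := by
    rw [Finset.sum_ite_eq']
    split_ifs with hc
    exacts [rfl, hq.2.1 c hc]
  rw [lowerWeight_eq hq, h1, ← Finset.sum_add_distrib, ← hq.2.2]
  refine Finset.sum_le_sum fun d _ => ?_
  by_cases hd : d = c
  · subst hd; simp
  · by_cases hd' : d < c <;> simp [hd, hd', hq.1 d]

theorem lowerWeight_add_le (hq : q ∈ closedSimplex s) {c d : P} (hcd : c < d) :
    lowerWeight q c + q c ≤ lowerWeight q d := by
  classical
  have h1 : q c = ∑ d ∈ s, if d = c then q d else 0 := by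
    rw [Finset.sum_ite_eq']
    split_ifs with hc
    exacts [rfl, hq.2.1 c hc]
  rw [lowerWeight_eq hq, lowerWeight_eq hq, h1, ← Finset.sum_add_distrib]
  refine Finset.sum_le_sum fun e _ => ?_
  by_cases he : e = c
  · subst he; simp [hcd]
  · by_cases he' : e < c
    · simp [he, he', he'.trans hcd]
    · by_cases he'' : e < d <;> simp [he, he', he'', hq.1 e]

theorem stepWeight_nonneg (hq : q ∈ closedSimplex s) (σ : ℝ) (c : P) (k : ℤ) :
    0 ≤ stepWeight q σ c k :=
  sub_nonneg.mpr (cut_mono (by linarith [hq.1 c]) k)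

theorem stepWeight_ne_zero (hq : q ∈ closedSimplex s) {σ : ℝ} {c : P} {k : ℤ}
    (h : stepWeight q σ c k ≠ 0) : c ∈ s ∧ lowerWeight q c - σ < k + 1 ∧
      k < lowerWeight q c + q c - σ := by
  refine ⟨?_, ?_, ?_⟩ <;> by_contra h' <;> refine h ?_
  · rw [stepWeight, hq.2.1 c h', add_zero, sub_self]
  · rw [not_lt] at h'
    rw [stepWeight, cut_of_ge h', cut_of_ge (by linarith [hq.1 c]), sub_self]
  · rw [not_lt] at h'
    rw [stepWeight, cut_of_le h', cut_of_le (by linarith [hq.1 c]), sub_self]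

theorem stepWeight_range (hq : q ∈ closedSimplex s) {σ : ℝ} {c : P} {k : ℤ}
    (h : stepWeight q σ c k ≠ 0) : -σ < k + 1 ∧ k < 1 - σ := by
  obtain ⟨-, h1, h2⟩ := stepWeight_ne_zero hq h
  have := lowerWeight_nonneg hq c
  have := lowerWeight_add_le_one hq c
  constructor <;> linarith

theorem stepWeight_index_le (hq : q ∈ closedSimplex s) {σ : ℝ} {c d : P} {k l : ℤ}
    (h : stepWeight q σ c k ≠ 0) (h' : stepWeight q σ d l ≠ 0) : l ≤ k + 1 := by
  have h1 := (stepWeight_range hq h).1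
  have h2 := (stepWeight_range hq h').2
  have : (l : ℝ) < ((k + 2 : ℤ) : ℝ) := by push_cast; linarith
  have := Int.cast_lt.mp this
  omega

theorem stepWeight_index_mono (hq : q ∈ closedSimplex s) {σ : ℝ} {c d : P} {k l : ℤ} (hcd : c < d)
    (h : stepWeight q σ c k ≠ 0) (h' : stepWeight q σ d l ≠ 0) : k ≤ l := by
  have h1 := (stepWeight_ne_zero hq h).2.2
  have h2 := (stepWeight_ne_zero hq h').2.1
  have := lowerWeight_add_le hq hcd
  have : (k : ℝ) < ((l + 1 : ℤ) : ℝ) := by push_cast; linarith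
  have := Int.cast_lt.mp this
  omega

/-- A finite set containing all relevant values of `k`. -/
theorem mem_Ico_of_stepWeight_ne_zero (hq : q ∈ closedSimplex s) {σ : ℝ} {N : ℕ} (hσ : |σ| ≤ N)
    {c : P} {k : ℤ} (h : stepWeight q σ c k ≠ 0) : k ∈ Finset.Ico (-N : ℤ) (N + 1) := by
  obtain ⟨h1, h2⟩ := stepWeight_range hq h
  obtain ⟨h3, h4⟩ := abs_le.mp hσ
  have h5 : ((-N - 1 : ℤ) : ℝ) < k := by push_cast; linarith
  have h6 : (k : ℝ) < ((N + 1 : ℤ) : ℝ) := by push_cast; linarith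
  rw [Int.cast_lt] at h5 h6
  rw [Finset.mem_Ico]
  omega

theorem sum_stepWeight (hq : q ∈ closedSimplex s) {σ : ℝ} {N : ℕ} (hσ : |σ| ≤ N) (c : P) :
    ∑ k ∈ Finset.Ico (-N : ℤ) (N + 1), stepWeight q σ c k = q c := by
  have h0 := lowerWeight_nonneg hq c
  have h1 := lowerWeight_add_le_one hq c
  have h2 := hq.1 c
  obtain ⟨h3, h4⟩ := abs_le.mp hσ
  simp only [stepWeight, Finset.sum_sub_distrib]
  rw [sum_cut (by omega) (by push_cast; linarith) (by push_cast; linarith),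
    sum_cut (by omega) (by push_cast; linarith) (by push_cast; linarith)]
  ring

open Classical in
theorem pushWeight_eq (hq : q ∈ closedSimplex s) {σ : ℝ} {N : ℕ} (hσ : |σ| ≤ N) (f : P → ℤ → P)
    (v : P) : pushWeight f q σ v = ∑ a ∈ s ×ˢ Finset.Ico (-N : ℤ) (N + 1),
      if f a.1 a.2 = v then stepWeight q σ a.1 a.2 else 0 := by
  refine finsum_eq_sum_of_support_subset _ fun a ha => ?_
  have h : stepWeight q σ a.1 a.2 ≠ 0 := fun h => ha (by simp [h])
  exact Finset.mem_coe.mpr (Finset.mem_product.mpr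
    ⟨(stepWeight_ne_zero hq h).1, mem_Ico_of_stepWeight_ne_zero hq hσ h⟩)

theorem exists_of_pushWeight_ne_zero {σ : ℝ} {f : P → ℤ → P} {v : P}
    (h : pushWeight f q σ v ≠ 0) : ∃ c k, f c k = v ∧ stepWeight q σ c k ≠ 0 := by
  classical
  by_contra! h'
  refine h ?_
  refine (finsum_congr fun a => ?_).trans finsum_zero
  split_ifs with ha
  exacts [h' _ _ ha, rfl]

/-- Where `f` does not move the values of the step function of `q`, the point `q` is fixed. -/
theorem pushWeight_eq_self (hq : q ∈ closedSimplex s) {σ : ℝ} {f : P → ℤ → P}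
    (h : ∀ c ∈ s, ∀ k, stepWeight q σ c k ≠ 0 → f c k = c) (v : P) :
    pushWeight f q σ v = q v := by
  classical
  obtain ⟨N, hN⟩ := exists_nat_ge |σ|
  rw [pushWeight_eq hq hN, Finset.sum_product]
  have : ∀ c ∈ s, (∑ k ∈ Finset.Ico (-N : ℤ) (N + 1),
      if f c k = v then stepWeight q σ c k else 0) = if c = v then q c else 0 := by
    intro c hc
    have e : ∀ k, (if f c k = v then stepWeight q σ c k else 0) =
        if c = v then stepWeight q σ c k else 0 := fun k => by
      by_cases hk : stepWeight q σ c k = 0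
      · simp [hk]
      · rw [h c hc k hk]
    simp only [e]
    split_ifs
    exacts [sum_stepWeight hq hN c, Finset.sum_const_zero]
  rw [Finset.sum_congr rfl this, Finset.sum_ite_eq']
  split_ifs with hv
  exacts [rfl, (hq.2.1 v hv).symm]

variable {K : PreAbstractSimplicialComplex P} {φ : P ≃o P}
  (hK : ∀ s, s ∈ K.faces ↔ s.Nonempty ∧ ∀ v ∈ s, ∀ w ∈ s, (v ≤ w ∨ w ≤ v) ∧ w ≤ φ v)
  {f : P → ℤ → P} (hmono : ∀ {c d k l}, c ≤ d → k ≤ l → f c k ≤ f d l)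
  (hφ : ∀ c k, f (φ c) (k + 1) = φ (f c k))
include hK hmono hφ

theorem pushWeight_mem (hs : s ∈ K.faces) (hq : q ∈ closedSimplex s) (σ : ℝ) :
    ∃ t ∈ K.faces, pushWeight f q σ ∈ closedSimplex t := by
  classical
  obtain ⟨N, hN⟩ := exists_nat_ge |σ|
  have hs' := ((hK s).mp hs).2
  set I := s ×ˢ Finset.Ico (-N : ℤ) (N + 1)
  set t := (I.filter fun a => stepWeight q σ a.1 a.2 ≠ 0).image fun a => f a.1 a.2 with ht
  have hmem : ∀ a ∈ I, stepWeight q σ a.1 a.2 ≠ 0 → f a.1 a.2 ∈ t := fun a ha h =>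
    Finset.mem_image_of_mem _ (Finset.mem_filter.mpr ⟨ha, h⟩)
  have hsum : ∑ v ∈ t, pushWeight f q σ v = 1 := by
    simp only [pushWeight_eq hq hN]
    rw [Finset.sum_comm]
    calc _ = ∑ a ∈ I, stepWeight q σ a.1 a.2 := by
          refine Finset.sum_congr rfl fun a ha => ?_
          rw [Finset.sum_ite_eq]
          split_ifs with h
          · rfl
          · by_contra h'
            exact h (hmem a ha (Ne.symm h'))
      _ = 1 := by
          rw [Finset.sum_product, Finset.sum_congr rfl fun c _ => sum_stepWeight hq hN c, hq.2.2]
  refine ⟨t, (hK t).mpr ⟨?_, ?_⟩, fun v => ?_, fun v hv => ?_, hsum⟩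
  · by_contra hne
    rw [Finset.not_nonempty_iff_eq_empty] at hne
    simp [hne] at hsum
  · have key : ∀ v ∈ t, ∃ c ∈ s, ∃ k, stepWeight q σ c k ≠ 0 ∧ f c k = v := by
      intro v hv
      obtain ⟨a, ha, rfl⟩ := Finset.mem_image.mp hv
      obtain ⟨ha, ha'⟩ := Finset.mem_filter.mp ha
      exact ⟨a.1, (Finset.mem_product.mp ha).1, a.2, ha', rfl⟩
    intro v hv w hw
    obtain ⟨c, hc, k, hk, rfl⟩ := key v hv
    obtain ⟨d, hd, l, hl, rfl⟩ := key w hw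
    refine ⟨?_, ?_⟩
    · rcases (hs' c hc d hd).1 with h | h
      · rcases h.eq_or_lt with rfl | h
        · rcases le_total k l with h' | h'
          exacts [.inl (hmono le_rfl h'), .inr (hmono le_rfl h')]
        · exact .inl (hmono h.le (stepWeight_index_mono hq h hk hl))
      · rcases h.eq_or_lt with rfl | h
        · rcases le_total k l with h' | h'
          exacts [.inl (hmono le_rfl h'), .inr (hmono le_rfl h')]
        · exact .inr (hmono h.le (stepWeight_index_mono hq h hl hk))
    · rw [← hφ]
      exact hmono (hs' c hc d hd).2 (stepWeight_index_le hq hk hl)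
  · rw [pushWeight_eq hq hN]
    refine Finset.sum_nonneg fun a _ => ?_
    split_ifs
    exacts [stepWeight_nonneg hq _ _ _, le_rfl]
  · by_contra h
    rw [pushWeight_eq hq hN] at h
    obtain ⟨a, ha, h⟩ := Finset.exists_ne_zero_of_sum_ne_zero h
    rw [ne_eq, ite_eq_right_iff, Classical.not_imp] at h
    exact hv (h.1 ▸ hmem a ha h.2)

omit hK hmono hφ in
theorem continuous_stepWeight {Z : Type*} [TopologicalSpace Z] {Q : Z → P → ℝ} {σ : Z → ℝ}
    (hQs : ∀ x, Q x ∈ closedSimplex s) (hQ : ∀ v, Continuous fun x => Q x v) (hσ : Continuous σ)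
    (c : P) (k : ℤ) : Continuous fun x => stepWeight (Q x) (σ x) c k := by
  classical
  have h1 : Continuous fun x => lowerWeight (Q x) c := by
    simp only [fun x => lowerWeight_eq (hQs x)]
    refine continuous_finsetSum _ fun d _ => ?_
    split_ifs
    exacts [hQ d, continuous_const]
  exact ((continuous_cut k).comp ((h1.add (hQ c)).sub hσ)).sub
    ((continuous_cut k).comp (h1.sub hσ))

/-- The image of `p` under the map of step functions given by `f` and `σ`. -/
noncomputable def push (p : Realization K) (σ : ℝ) : Realization K :=
  ⟨pushWeight f p.1 σ, by
    obtain ⟨s, hs, hq⟩ := p.2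
    exact pushWeight_mem hK hmono hφ hs hq σ⟩

theorem push_apply (p : Realization K) (σ : ℝ) (v : P) :
    (push hK hmono hφ p σ).1 v = pushWeight f p.1 σ v := rfl

theorem continuous_push (hs : s ∈ K.faces) {Z : Type*} [TopologicalSpace Z]
    {Q : Z → closedSimplex s} (hQ : Continuous Q) {σ : Z → ℝ} (hσ : Continuous σ) {N : ℕ}
    (hN : ∀ x, |σ x| ≤ N) :
    Continuous fun x => push hK hmono hφ (simplexInclusion K ⟨s, hs⟩ (Q x)) (σ x) := by
  classical
  have e : ∀ x v, (push hK hmono hφ (simplexInclusion K ⟨s, hs⟩ (Q x)) (σ x)).1 v =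
      ∑ a ∈ s ×ˢ Finset.Ico (-N : ℤ) (N + 1),
        if f a.1 a.2 = v then stepWeight (Q x).1 (σ x) a.1 a.2 else 0 := fun x v =>
    pushWeight_eq (Q x).2 (hN x) f v
  refine continuous_of_finite_support
    ((s ×ˢ Finset.Ico (-N : ℤ) (N + 1)).image fun a => f a.1 a.2) (fun x v hv => ?_) fun v => ?_
  · rw [e]
    refine Finset.sum_eq_zero fun a ha => if_neg ?_
    rintro rfl
    exact hv (Finset.mem_image_of_mem _ ha)
  · simp only [e]
    refine continuous_finsetSum _ fun a _ => ?_
    split_ifs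
    · exact continuous_stepWeight (fun x => (Q x).2)
        (fun v => (continuous_apply v).comp (continuous_subtype_val.comp hQ)) hσ _ _
    · exact continuous_const

/-- If `f c k = c` whenever `- ε k` is large, then letting `σ = ε / t` tend to infinity deforms the
identity, at `t = 0`, into the map given by `f` and `σ = ε`. On each simplex the homotopy is
constant near `t = 0`. -/
theorem exists_homotopic_push (ε : ℤ) (hε : ε = 1 ∨ ε = -1)
    (hstab : ∀ c, ∃ N : ℕ, ∀ k : ℤ, N ≤ -ε * k → f c k = c) :
    ∃ J : C(Realization K, Realization K), (ContinuousMap.id _).Homotopic J ∧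
      ∀ p, J p = push hK hmono hφ p ε := by
  classical
  have hεabs : |(ε : ℝ)| = 1 := by rcases hε with rfl | rfl <;> simp
  let F : Realization K → unitInterval → Realization K := fun p t =>
    if (t : ℝ) = 0 then p else push hK hmono hφ p (ε / t)
  have hF : ∀ s : K.faces, Continuous fun x : closedSimplex (s : Finset P) × unitInterval =>
      F (simplexInclusion K s x.1) x.2 := by
    rintro ⟨s, hs⟩
    choose N hN using hstab
    set M : ℕ := s.sup N + 1 with hM
    have hM0 : (0 : ℝ) < M := by positivity
    have hstable : ∀ (q : closedSimplex s) (τ : ℝ), M ≤ τ →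
        push hK hmono hφ (simplexInclusion K ⟨s, hs⟩ q) (ε * τ) =
          simplexInclusion K ⟨s, hs⟩ q := by
      intro q τ hτ
      refine Subtype.ext (funext fun v => pushWeight_eq_self q.2 (fun c hc k hk => ?_) v)
      obtain ⟨h1, h2⟩ := stepWeight_range q.2 hk
      refine hN c k ?_
      have h3 : N c ≤ s.sup N := Finset.le_sup hc
      have h4 : (((s.sup N : ℕ) : ℤ) : ℝ) < ((-ε * k + 1 : ℤ) : ℝ) := by
        have : (M : ℝ) = (((s.sup N : ℕ) : ℤ) : ℝ) + 1 := by rw [hM]; push_cast; rfl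
        push_cast
        push_cast at this
        rcases hε with rfl | rfl <;> push_cast at h1 h2 ⊢ <;> linarith
      have := Int.cast_lt.mp h4
      omega
    have e : (fun x : closedSimplex s × unitInterval => F (simplexInclusion K ⟨s, hs⟩ x.1) x.2) =
        fun x => push hK hmono hφ (simplexInclusion K ⟨s, hs⟩ x.1)
          (ε * (max (x.2 : ℝ) (M : ℝ)⁻¹)⁻¹) := by
      funext x
      rcases le_total (M : ℝ)⁻¹ (x.2 : ℝ) with h | h
      · have h0 : (x.2 : ℝ) ≠ 0 := ((inv_pos.mpr hM0).trans_le h).ne'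
        rw [max_eq_left h]
        exact if_neg h0
      · rw [max_eq_right h, inv_inv, hstable _ _ le_rfl]
        by_cases h0 : (x.2 : ℝ) = 0
        · exact if_pos h0
        · refine (if_neg h0).trans ?_
          rw [div_eq_mul_inv]
          refine hstable _ _ ?_
          rwa [le_inv_comm₀ hM0 (lt_of_le_of_ne x.2.2.1 (Ne.symm h0))]
    rw [e]
    have hpos : ∀ x : closedSimplex s × unitInterval, 0 < max (x.2 : ℝ) (M : ℝ)⁻¹ := fun x =>
      lt_max_of_lt_right (inv_pos.mpr hM0)
    refine continuous_push hK hmono hφ hs continuous_fst (N := M) ?_ fun x => ?_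
    · refine continuous_const.mul (Continuous.inv₀ ?_ fun x => (hpos x).ne')
      fun_prop
    · rw [abs_mul, hεabs, one_mul, abs_of_pos (inv_pos.mpr (hpos x)), inv_le_comm₀ (hpos x) hM0]
      exact le_max_right _ _
  have hF' : ∀ p, Continuous (F p) := by
    rintro ⟨q, s, hs, hq⟩
    exact (hF ⟨s, hs⟩).comp ((continuous_const (y := (⟨q, hq⟩ : closedSimplex s))).prodMk
      continuous_id)
  let H : Realization K → C(unitInterval, Realization K) := fun p => ⟨F p, hF' p⟩
  have hH : Continuous H := continuous_realization_iff.mpr fun s =>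
    (ContinuousMap.curry ⟨_, hF s⟩).continuous
  have hH' : Continuous fun x : unitInterval × Realization K => F x.2 x.1 :=
    (ContinuousMap.continuous_uncurry_of_continuous ⟨H, hH⟩).comp continuous_swap
  have h1 : ∀ p, F p 1 = push hK hmono hφ p ε := fun p => by simp [F]
  refine ⟨⟨fun p => F p 1, hH'.comp (continuous_const.prodMk continuous_id)⟩,
    ⟨⟨⟨_, hH'⟩, fun p => ?_, fun p => rfl⟩⟩, h1⟩
  simp [F]

omit hK hmono hφ in
/-- At `σ = ε = ± 1` only the values `f c (-ε)` occur. -/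
theorem exists_of_pushWeight_int_ne_zero (hq : q ∈ closedSimplex s) (ε : ℤ) {v : P}
    (h : pushWeight f q ε v ≠ 0) : ∃ c, q c ≠ 0 ∧ f c (-ε) = v := by
  obtain ⟨c, k, hf, hk⟩ := exists_of_pushWeight_ne_zero h
  obtain ⟨h1, h2⟩ := stepWeight_range hq hk
  have h3 : ((-ε : ℤ) : ℝ) < ((k + 1 : ℤ) : ℝ) := by push_cast; exact h1
  have h4 : (k : ℝ) < ((1 - ε : ℤ) : ℝ) := by push_cast; exact h2
  rw [Int.cast_lt] at h3 h4
  obtain rfl : k = -ε := by omega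
  refine ⟨c, fun h0 => hk ?_, hf⟩
  rw [stepWeight, h0, add_zero, sub_self]

omit hmono hφ in
/-- The complex of all chains contained in some `[x, φ x]` is contractible, for a lattice with an
automorphism `φ` whose powers move every element above every other one. For every `b`, the maps
`c ↦ c ⊔ b` and `c ↦ c ⊓ b` are both homotopic to the identity, and their composite is constant. -/
theorem contractibleSpace_realization (hle : ∀ x, x ≤ φ x)
    (hcof : ∀ x y, ∃ n : ℕ, y ≤ (φ ^ n) x) (x : P) : ContractibleSpace (Realization K) := by
  have hmonoφ : ∀ k l : ℤ, k ≤ l → ∀ y, (φ ^ k) y ≤ (φ ^ l) y := by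
    intro k l hkl y
    induction l, hkl using Int.leInduction with
    | base => exact le_rfl
    | succ l _ ih =>
      rw [add_comm, zpow_one_add]
      exact ih.trans (hle _)
  have hsucc : ∀ (k : ℤ) y, (φ ^ (k + 1)) y = φ ((φ ^ k) y) := fun k y => by
    rw [add_comm, zpow_one_add]; rfl
  -- The homotopies end at `σ = ± 1`, where only `k = ∓ 1` occurs: the base points of the two
  -- families are shifted against each other so that both end maps involve the same `b`.
  set b := (φ ^ (-1 : ℤ)) x with hb
  set y := (φ ^ (-1 : ℤ)) b with hy
  have hyb : (φ ^ (1 : ℤ)) y = b := by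
    have : (φ ^ (1 : ℤ) * φ ^ (-1 : ℤ)) b = b := by rw [← zpow_add]; rfl
    exact this
  have hneg : ∀ (n : ℕ) (u v : P), u ≤ (φ ^ n) v → (φ ^ (-n : ℤ)) u ≤ v := by
    intro n u v h
    have h1 := (φ ^ (-n : ℤ)).monotone h
    have h2 : (φ ^ (-n : ℤ) * φ ^ n) v = v := by
      rw [zpow_neg, zpow_natCast, inv_mul_cancel]; rfl
    exact h1.trans h2.le
  obtain ⟨J, hJ, hJ'⟩ := exists_homotopic_push hK (f := fun c k => c ⊔ (φ ^ k) x)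
    (fun {_ _ _ _} h1 h2 => sup_le_sup h1 ((hmonoφ _ _ h2 x)))
    (fun c k => by rw [hsucc, ← φ.map_sup]) 1 (.inl rfl) (fun c => by
      obtain ⟨n, hn⟩ := hcof c x
      refine ⟨n, fun k hk => sup_eq_left.mpr ?_⟩
      exact (hmonoφ k (-n) (by omega) x).trans (hneg n x c hn))
  obtain ⟨M, hM, hM'⟩ := exists_homotopic_push hK (f := fun c k => c ⊓ (φ ^ k) y)
    (fun {_ _ _ _} h1 h2 => inf_le_inf h1 ((hmonoφ _ _ h2 y)))
    (fun c k => by rw [hsucc, ← φ.map_inf]) (-1) (.inr rfl) (fun c => by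
      obtain ⟨n, hn⟩ := hcof y c
      refine ⟨n, fun k hk => inf_eq_left.mpr ?_⟩
      exact hn.trans (by simpa using hmonoφ n k (by omega) y))
  have hzero : ∀ p v, v ≠ b → (M (J p)).1 v = 0 := by
    intro p v hv
    by_contra h
    obtain ⟨t, -, ht⟩ := (J p).2
    rw [hM', push_apply] at h
    obtain ⟨c, hc, rfl⟩ := exists_of_pushWeight_int_ne_zero ht (-1) h
    obtain ⟨s, -, hs⟩ := p.2
    rw [hJ', push_apply] at hc
    obtain ⟨d, -, rfl⟩ := exists_of_pushWeight_int_ne_zero hs 1 hc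
    refine hv ?_
    change (d ⊔ b) ⊓ (φ ^ (1 : ℤ)) y = b
    rw [hyb, inf_eq_right]
    exact le_sup_right
  have hbs : ({b} : Finset P) ∈ K.faces := by
    rw [hK]
    simpa using hle b
  have hone : ∀ p, (M (J p)).1 b = 1 := by
    intro p
    obtain ⟨t, -, -, hout, hsum⟩ := (M (J p)).2
    have hbt : b ∈ t := by
      by_contra hbt
      rw [Finset.sum_eq_zero fun v hv => hzero p v fun e => hbt (e ▸ hv)] at hsum
      exact zero_ne_one hsum
    rwa [Finset.sum_eq_single_of_mem b hbt fun v _ hv => hzero p v hv] at hsum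
  have hmem : b ∈ ({b} : Finset P) := Finset.mem_singleton_self b
  let p₀ := M (J (edgePoint hbs hmem hmem 0))
  have hconst : M.comp J = ContinuousMap.const _ p₀ := by
    ext1 p
    refine Subtype.ext (funext fun v => ?_)
    by_cases hv : v = b
    · subst hv
      exact (hone p).trans (hone _).symm
    · exact (hzero p v hv).trans (hzero _ v hv).symm
  rw [contractible_iff_id_nullhomotopic]
  exact ⟨p₀, hconst ▸ (hM.comp hJ : (_ : C(_, _)).Homotopic (M.comp J))⟩

end Push

/-! ### Weakly ordered sets with a generating automorphism -/

section PhiRel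

variable {P : Type*} {r : P → P → Prop}

theorem weakOrder_trans_left (hr : IsWeakOrder r) {a b c d : P} (hab : r a b) (hbc : r b c)
    (hcd : r c d) (hac : r a c) (had : r a d) : r b d :=
  ((hr.assoc a b c d hab hbc hcd).mpr ⟨⟨hab, hbc, hac⟩, hac, hcd, had⟩).1.2.2

theorem weakOrder_trans_right (hr : IsWeakOrder r) {a b c d : P} (hab : r a b) (hbc : r b c)
    (hcd : r c d) (hbd : r b d) (had : r a d) : r a c :=
  ((hr.assoc a b c d hab hbc hcd).mp ⟨⟨hbc, hcd, hbd⟩, hab, hbd, had⟩).1.2.2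

variable (hr : IsWeakOrder r) {φ : r ≃r r} (hφ : ∀ x, r x (φ x))
include hr hφ

/-- If `x ≤ a ≤ b` in `[x, φ x]`, then `b ≤ φ a`. -/
theorem rel_apply_of_mem {x a b : P} (hxa : r x a) (haφ : r a (φ x)) (hbφ : r b (φ x))
    (hab : r a b) : r b (φ a) :=
  weakOrder_trans_left hr hab hbφ (φ.map_rel_iff.mpr hxa) haφ (hφ a)

theorem phiRel_iff {a b : P} : phiRel r φ a b ↔ r a b ∧ r b (φ a) := by
  constructor
  · rintro ⟨hab, x, ha, hb⟩
    exact ⟨hab, rel_apply_of_mem hr hφ ha.1 ha.2 hb.2 hab⟩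
  · rintro ⟨hab, hb⟩
    exact ⟨hab, a, ⟨hr.refl a, hφ a⟩, hab, hb⟩

theorem phiRel_of_mem {x a b : P} (ha : phiRel r φ x a) (hb : phiRel r φ x b) (hab : r a b) :
    phiRel r φ a b := by
  rw [phiRel_iff hr hφ] at ha hb ⊢
  exact ⟨hab, rel_apply_of_mem hr hφ ha.1 ha.2 hb.2 hab⟩

/-- The relation `b ∈ [a, φ a]` inherits the associativity law of the weak order. -/
theorem isWeakOrder_phiRel : IsWeakOrder (phiRel r φ) where
  refl a := (phiRel_iff hr hφ).mpr ⟨hr.refl a, hφ a⟩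
  antisymm a b h1 h2 := hr.antisymm a b h1.1 h2.1
  assoc a b c d hab hbc hcd := by
    constructor
    · rintro ⟨⟨-, -, hbd⟩, -, -, had⟩
      have hac : r a c := weakOrder_trans_right hr hab.1 hbc.1 hcd.1 hbd.1 had.1
      have hdφ := ((phiRel_iff hr hφ).mp had).2
      have hac' : phiRel r φ a c :=
        (phiRel_iff hr hφ).mpr ⟨hac, weakOrder_trans_left hr hac hcd.1 hdφ had.1 (hφ a)⟩
      exact ⟨⟨hab, hbc, hac'⟩, hac', hcd, had⟩
    · rintro ⟨⟨-, -, hac⟩, -, -, had⟩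
      have hbd' : phiRel r φ b d := phiRel_of_mem hr hφ hab had
        (weakOrder_trans_left hr hab.1 hbc.1 hcd.1 hac.1 had.1)
      exact ⟨⟨hbc, hcd, hbd'⟩, hab, hbd', had⟩

theorem isGarsideRel_phiRel
    (hlat : ∀ x, IsLatticeRel (Subrel r (· ∈ interval r x (φ x)))) :
    IsGarsideRel (phiRel r φ) φ.toEquiv where
  weakOrder := isWeakOrder_phiRel hr hφ
  map_iff a b := by
    change phiRel r φ (φ a) (φ b) ↔ _
    rw [phiRel_iff hr hφ, phiRel_iff hr hφ, φ.map_rel_iff, φ.map_rel_iff]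
  right_apply a b h := by
    rw [phiRel_iff hr hφ] at h
    exact (phiRel_iff hr hφ).mpr ⟨h.2, φ.map_rel_iff.mpr h.1⟩
  exists_join x a b ha hb := by
    have ha' := (phiRel_iff hr hφ).mp ha
    have hb' := (phiRel_iff hr hφ).mp hb
    obtain ⟨⟨j, hj⟩, h1, h2⟩ := (hlat x).exists_join ⟨a, ha'⟩ ⟨b, hb'⟩
    have hxj : phiRel r φ x j := (phiRel_iff hr hφ).mpr hj
    refine ⟨j, hxj, phiRel_of_mem hr hφ ha hxj (h1 ⟨a, ha'⟩ (by simp)),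
      phiRel_of_mem hr hφ hb hxj (h1 ⟨b, hb'⟩ (by simp)), fun k hk hak hbk => ?_⟩
    refine phiRel_of_mem hr hφ hxj hk (h2 ⟨k, (phiRel_iff hr hφ).mp hk⟩ ?_)
    rintro s (rfl | rfl)
    exacts [hak.1, hbk.1]

theorem singleton_mem_phiComplex (v : P) : {v} ∈ (phiComplex r φ).faces :=
  ⟨Finset.singleton_nonempty v, by simp, v, by simpa using ⟨hr.refl v, hφ v⟩⟩

theorem phiRel_of_face {s : Finset P} (hs : s ∈ (phiComplex r φ).faces) :
    ∃ x, (∀ u ∈ s, phiRel r φ x u) ∧ ∀ u ∈ s, ∀ v ∈ s, phiRel r φ u v ∨ phiRel r φ v u := by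
  obtain ⟨-, hc, x, hx⟩ := hs
  have h1 : ∀ u ∈ s, phiRel r φ x u := fun u hu => (phiRel_iff hr hφ).mpr (hx hu)
  refine ⟨x, h1, fun u hu v hv => ?_⟩
  by_cases huv : u = v
  · exact .inl (huv ▸ (isWeakOrder_phiRel hr hφ).refl u)
  · exact (hc hu hv huv).imp (phiRel_of_mem hr hφ (h1 u hu) (h1 v hv))
      (phiRel_of_mem hr hφ (h1 v hv) (h1 u hu))

theorem pair_mem_phiComplex [DecidableEq P] {a b : P} (h : phiRel r φ a b) :
    {a, b} ∈ (phiComplex r φ).faces := by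
  rw [phiRel_iff hr hφ] at h
  refine ⟨by simp, ?_, a, ?_⟩
  · rw [Finset.coe_pair]
    exact IsChain.pair h.1
  · rw [Finset.coe_pair]
    rintro x (rfl | rfl)
    exacts [⟨hr.refl _, hφ _⟩, h]

/-- The edges of `X_φ` may be oriented by `≤_φ`; it suffices to define a cocycle on oriented
edges. -/
theorem exists_coboundary_phiRel [SimplyConnectedSpace (Realization (phiComplex r φ))]
    {G : Type*} [Group G] (c : P → P → G)
    (hc : ∀ u v w, phiRel r φ u v → phiRel r φ v w → phiRel r φ u w → c u v * c v w = c u w) :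
    ∃ h : P → G, ∀ u v, phiRel r φ u v → c u v = (h u)⁻¹ * h v := by
  classical
  have hw := isWeakOrder_phiRel hr hφ
  let T : P → P → G := fun u v => if phiRel r φ u v then c u v else (c v u)⁻¹
  have hT : ∀ u v, phiRel r φ u v → T u v = c u v := fun u v h => if_pos h
  have hT' : ∀ u v, phiRel r φ u v → T v u = (c u v)⁻¹ := by
    intro u v h
    by_cases h' : phiRel r φ v u
    · obtain rfl := hw.antisymm u v h h'
      have h1 := hc u u u h h h
      rw [mul_eq_left] at h1
      rw [hT u u h, h1, inv_one]
    · exact if_neg h'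
  obtain ⟨h, hh⟩ := exists_coboundary (singleton_mem_phiComplex hr hφ) T (by
    intro s hs u hu v hv w hw
    obtain ⟨x, hx, hs'⟩ := phiRel_of_face hr hφ hs
    have htrans : ∀ {a b d}, a ∈ s → b ∈ s → d ∈ s → phiRel r φ a b → phiRel r φ b d →
        phiRel r φ a d := fun ha hb hd hab hbd => phiRel_of_mem hr hφ (hx _ ha) (hx _ hd)
      (weakOrder_trans_left hr (hx _ ha).1 hab.1 hbd.1 (hx _ hb).1 (hx _ hd).1)
    rcases hs' u hu v hv with h1 | h1 <;> rcases hs' v hv w hw with h2 | h2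
    · have h3 := htrans hu hv hw h1 h2
      rw [hT _ _ h1, hT _ _ h2, hT _ _ h3, hc _ _ _ h1 h2 h3]
    · rcases hs' u hu w hw with h3 | h3
      · rw [hT _ _ h1, hT' _ _ h2, hT _ _ h3, ← hc _ _ _ h3 h2 h1, mul_inv_cancel_right]
      · rw [hT _ _ h1, hT' _ _ h2, hT' _ _ h3, ← hc _ _ _ h3 h1 h2, mul_inv_rev,
          mul_inv_cancel_left]
    · rcases hs' u hu w hw with h3 | h3
      · rw [hT' _ _ h1, hT _ _ h2, hT _ _ h3, ← hc _ _ _ h1 h3 h2, inv_mul_cancel_left]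
      · rw [hT' _ _ h1, hT _ _ h2, hT' _ _ h3, ← hc _ _ _ h2 h3 h1, mul_inv_rev,
          inv_mul_cancel_right]
    · have h3 := htrans hw hv hu h2 h1
      rw [hT' _ _ h1, hT' _ _ h2, hT' _ _ h3, ← hc _ _ _ h2 h1 h3, mul_inv_rev])
  refine ⟨h, fun u v huv => ?_⟩
  rw [← hT u v huv]
  exact hh _ (pair_mem_phiComplex hr hφ huv) u (by simp) v (by simp)

/-- The lengths of the edges of a simply connected `X_φ` are differences of a height function. -/
theorem exists_height [SimplyConnectedSpace (Realization (phiComplex r φ))]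
    (hhom : IsHomogeneous r) :
    ∃ h : P → ℤ, ∀ a b, phiRel r φ a b → a ≠ b → h a < h b := by
  obtain ⟨ℓ, hadd, hzero⟩ := hhom
  obtain ⟨h, hh⟩ := exists_coboundary_phiRel hr hφ
    (fun u v => Multiplicative.ofAdd (ℓ u v : ℤ)) fun u v w huv hvw huw => by
      rw [← ofAdd_add, hadd u v w ⟨huv.1, hvw.1, huw.1⟩, Nat.cast_add]
  refine ⟨fun v => (h v).toAdd, fun a b hab hne => ?_⟩
  have h1 : (ℓ a b : ℤ) = -(h a).toAdd + (h b).toAdd := congrArg Multiplicative.toAdd (hh a b hab)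
  have h2 : ℓ a b ≠ 0 := fun e => hne ((hzero a b hab.1).mp e)
  change (h a).toAdd < (h b).toAdd
  omega

end PhiRel

/-- The lattice structure given by a partial order with joins and meets of pairs. -/
noncomputable abbrev latticeOfRel {P : Type*} {R : P → P → Prop} (hR : IsPartialOrder P R)
    (hjoin : ∀ a b, ∃ z, IsJoin R {a, b} z) (hmeet : ∀ a b, ∃ z, IsMeet R {a, b} z) :
    Lattice P where
  le := R
  le_refl := hR.refl
  le_trans := hR.trans
  le_antisymm := hR.antisymm
  sup a b := (hjoin a b).choose
  inf a b := (hmeet a b).choose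
  le_sup_left a b := (hjoin a b).choose_spec.1 a (by simp)
  le_sup_right a b := (hjoin a b).choose_spec.1 b (by simp)
  sup_le a b c hac hbc := (hjoin a b).choose_spec.2 c (by rintro s (rfl | rfl) <;> assumption)
  inf_le_left a b := (hmeet a b).choose_spec.1 a (by simp)
  inf_le_right a b := (hmeet a b).choose_spec.1 b (by simp)
  le_inf a b c hab hac := (hmeet b c).choose_spec.2 a (by rintro s (rfl | rfl) <;> assumption)

theorem theorem1p3 {P : Type*} (r : P → P → Prop) (hr : IsWeakOrder r) (hhom : IsHomogeneous r)
    (φ : r ≃r r) (hgen : Generates r φ)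
    (hφ : ∀ x, Strict r x (φ x))
    (hsc : SimplyConnectedSpace (Realization (phiComplex r φ)))
    (hlat : ∀ x, IsLatticeRel (Subrel r (· ∈ interval r x (φ x)))) :
    IsPartialOrder P (WeakChainRel r) ∧
    (∀ x, IsLatticeRel (Subrel (WeakChainRel r) (fun y => WeakChainRel r x y)) ∧
      IsHomogeneous (Subrel (WeakChainRel r) (fun y => WeakChainRel r x y))) ∧
    (∀ x, IsLatticeRel (Subrel (WeakChainRel r) (fun y => WeakChainRel r y x)) ∧
      IsHomogeneous (Subrel (WeakChainRel r) (fun y => WeakChainRel r y x))) ∧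
    ContractibleSpace (Realization (phiComplex r φ)) := by
  classical
  have hφ' : ∀ x, r x (φ x) := fun x => (hφ x).1
  have hrel : WeakChainRel r = WeakChainRel (phiRel r φ) := by
    funext a b
    refine propext ⟨fun h => ?_, fun h => Relation.ReflTransGen.mono
      (fun _ _ h => ⟨h.1.1, h.2⟩) _ _ h⟩
    induction h with
    | refl => exact .refl
    | tail _ h ih => exact ih.trans (hgen _ _ h.1)
  rw [hrel]
  have G : IsGarsideRel (phiRel r φ) φ.toEquiv :=
    isGarsideRel_phiRel hr hφ' hlat
  obtain ⟨h, hh⟩ := exists_height hr hφ' hhom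
  have hconn : ∀ u v, Relation.EqvGen (phiRel r φ) u v := by
    intro u v
    have : ∀ a b, Relation.EqvGen (fun a b => phiRel r φ a b ∨ phiRel r φ b a) a b →
        Relation.EqvGen (phiRel r φ) a b := by
      intro a b hab
      induction hab with
      | rel a b hab => exact hab.elim (.rel _ _) fun h => .symm _ _ (.rel _ _ h)
      | refl => exact .refl _
      | symm _ _ _ ih => exact .symm _ _ ih
      | trans _ _ _ _ _ ih1 ih2 => exact .trans _ _ _ ih1 ih2
    refine this u v (eqvGen_of_connected (singleton_mem_phiComplex hr hφ') ?_ u v)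
    intro s hs
    exact (phiRel_of_face hr hφ' hs).choose_spec.2
  have huniq : ∀ {x z : P} {v w : List P}, IsWord (phiRel r φ) z x v →
      IsWord (phiRel r φ) z x w → WordEqv (phiRel r φ) z x v w :=
    wordEqv_of_isWord G hh hconn fun F c hc => exists_coboundary_phiRel hr hφ' c hc
  have hpo := isPartialOrder_weakChainRel hh
  have hjoin := exists_isJoin_weakChainRel G hh huniq hconn
  have hmeet := exists_isMeet_weakChainRel G hh huniq hconn
  have hhomog := isHomogeneous_subrel (r := WeakChainRel (phiRel r φ)) (h := h)
    fun a b => height_lt_of_weakChainRel hh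
  refine ⟨hpo, fun x => ⟨isLatticeRel_subrel hpo _ ?_ ?_, hhomog _⟩,
    fun x => ⟨isLatticeRel_subrel hpo _ ?_ ?_, hhomog _⟩, ?_⟩
  · intro a b ha _
    obtain ⟨z, hz⟩ := hjoin a b
    exact ⟨z, hz, ha.trans (hz.1 a (by simp))⟩
  · intro a b ha hb
    obtain ⟨z, hz⟩ := hmeet a b
    exact ⟨z, hz, hz.2 x (by rintro s (rfl | rfl) <;> assumption)⟩
  · intro a b ha hb
    obtain ⟨z, hz⟩ := hjoin a b
    exact ⟨z, hz, hz.2 x (by rintro s (rfl | rfl) <;> assumption)⟩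
  · intro a b ha _
    obtain ⟨z, hz⟩ := hmeet a b
    exact ⟨z, hz, (hz.1 a (by simp)).trans ha⟩
  · let _ : Lattice P := latticeOfRel hpo hjoin hmeet
    let ψ : P ≃o P :=
      { toEquiv := φ.toEquiv
        map_rel_iff' := by
          intro a b
          refine ⟨fun hab => ?_, weakChainRel_map G⟩
          have h1 : WeakChainRel (phiRel r φ) (φ.toEquiv.symm (φ.toEquiv a))
              (φ.toEquiv.symm (φ.toEquiv b)) :=
            hab.lift φ.toEquiv.symm fun _ _ h =>
              ⟨G.symm_map h.1, φ.toEquiv.symm.injective.ne h.2⟩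
          rwa [Equiv.symm_apply_apply, Equiv.symm_apply_apply] at h1 }
    have hpow : ∀ (n : ℕ) x, (ψ ^ n) x = φ.toEquiv^[n] x := by
      intro n x
      induction n with
      | zero => rfl
      | succ n ih =>
        rw [Function.iterate_succ_apply', ← ih, pow_succ']
        rfl
    obtain ⟨p⟩ : Nonempty (Realization (phiComplex r φ)) := inferInstance
    obtain ⟨x, -⟩ := exists_barycentric_pos p
    refine contractibleSpace_realization (φ := ψ) (fun s => ?_)
      (fun x => weakChainRel_of_rel (G.apply_right x)) (fun x y => ?_) x
    · constructor
      · intro hs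
        obtain ⟨x, hx, hs'⟩ := phiRel_of_face hr hφ' hs
        refine ⟨hs.1, fun v hv w hw => ⟨(hs' v hv w hw).imp weakChainRel_of_rel
          weakChainRel_of_rel, ?_⟩⟩
        have h1 : WeakChainRel (phiRel r φ) w (φ x) :=
          weakChainRel_of_rel (G.right_apply x w (hx w hw))
        exact h1.trans (weakChainRel_map G (weakChainRel_of_rel (hx v hv)))
      · rintro ⟨hne, hs⟩
        have hS : ∀ v ∈ s, ∀ w ∈ s, v ≤ w → phiRel r φ v w := fun v hv w hw hvw =>
          rel_of_weakChainRel_apply G hh huniq hvw (hs v hv w hw).2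
        obtain ⟨m, hm⟩ := s.exists_minimal hne
        refine ⟨hne, fun v hv w hw _ => ?_, m, fun v hv => ?_⟩
        · exact (hs v hv w hw).1.imp (fun h => (hS v hv w hw h).1) fun h => (hS w hw v hv h).1
        · refine (phiRel_iff hr hφ').mp (hS m hm.1 v hv ?_)
          exact (hs m hm.1 v hv).1.elim id fun h => hm.2 hv h
    · obtain ⟨n, hn⟩ := (exists_weakChainRel_iterate G (hconn x y)).2
      exact ⟨n, by rw [hpow]; exact hn⟩
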